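/- **Conventions.** Let $\mathcal L$ be a compact metric space. A ($1$-dimensional) prototile set labelled by $\mathcal L$ assigns to each $c\in\mathcal L$ a compact interval $[\ell(c),r(c)]\subset\mathbb R$ with $\ell(c)<r(c)$ and $\ell(c)\le 0\le r(c)$, where $\ell,r:\mathcal L\to\mathbb R$ are continuous (equivalently, the interval depends continuously on $c$ in the Hausdorff metric). A tile $t$ with control point $a\in\mathbb R$ and label $c$ is the pair $(\mathrm{supp}(t),\mathrm{label}(t))=(a+[\ell(c),r(c)],\,c)$, and $t-x$ is the tile with control point $a-x$ and label $c$. A patch is a set of tiles with pairwise disjoint interiors and connected union of supports; a tiling is such a set of tiles whose supports cover $\mathbb R$. For a tiling $\mathbf T$ and $x\in\mathbb R$ put $\mathbf T-x=\{t-x : t\in\mathbf T\}$. The distance of two tiles is $d(t,t')=\max\{d_H(\mathrm{supp}(t),\mathrm{supp}(t')),\,d_{\mathcal L}(\mathrm{label}(t),\mathrm{label}(t'))\}$, with $d_H$ the Hausdorff distance. The distance $d(\mathbf T,\mathbf T')$ of two tilings is the infimum of all $\varepsilon\in(0,1]$ for which $\mathbf T$ and $\mathbf T'$ have finite patches, each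 covering the ball of radius $1/\varepsilon$ around the origin, whose tiles can be put in one-to-one correspondence with corresponding tiles at distance at most $\varepsilon$; it is $1$ if there is no such $\varepsilon$. Sets of tilings carry the topology of $d$. A *$1$-dimensional tiling space* is a closed, translation-invariant set $\Omega$ of tilings by one such prototile set. It is an *FLC tiling space* if, up to translation, only finitely many two-tile patches occur in the tilings of $\Omega$. Its *transversal* is the set of all $\mathbf T\in\Omega$ that have a tile with control point $0$. It is *strongly expansive* if there is $\varepsilon>0$ such that for all $\mathbf T,\mathbf T'\in\Omega$: if there is a homeomorphism $h:\mathbb R\to\mathbb R$ with $h(0)=0$ and $d(\mathbf T-x,\mathbf T'-h(x))<\varepsilon$ for all $x\in\mathbb R$, then $\mathbf T=\mathbf T'-x_0$ for some $x_0\in\mathbb R$ with $|x_0|<\varepsilon$. **Corollary.** Let $\Omega$ be a $1$-dimensional tiling space. Then $\Omega$ is homeomorphic to some $1$-dimensional FLC tiling space (with a possibly different label space and prototile set) if and only if $\Omega$ is strongly expansive and its transversal is totally disconnected. -/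

import Mathlib

universe u v

noncomputable section

namespace LineTiling

/-- A one-dimensional prototile set with label space `L`.  The prototile with label `c` has support
`[left c, right c]`, a compact nondegenerate interval (a closed set homeomorphic to a ball of `ℝ`)
with its control point placed at the origin.  Continuity of the end points says exactly that the
supports depend continuously on the label in the Hausdorff metric. -/
structure Prototiles (L : Type u) [MetricSpace L] where
  left : L → ℝ
  right : L → ℝ
  left_lt_right : ∀ c, left c < right c
  left_nonpos : ∀ c, left c ≤ 0
  right_nonneg : ∀ c, 0 ≤ right c
  continuous_left : Continuous left
  continuous_right : Continuous right

/-- A tile: the translate of the prototile with label `label` whose control point is at `pos`. -/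
@[ext]
structure Tile (L : Type u) where
  pos : ℝ
  label : L

/-- The action of `x` on a tile `t`, giving `t - x`. -/
def Tile.shift {L : Type u} (x : ℝ) (t : Tile L) : Tile L := ⟨t.pos - x, t.label⟩

variable {L : Type u} [MetricSpace L]

/-- The support of a tile. -/
def supp (P : Prototiles L) (t : Tile L) : Set ℝ :=
  Set.Icc (t.pos + P.left t.label) (t.pos + P.right t.label)

/-- Distinct tiles of the collection meet at most along their boundaries. -/
def NonOverlapping (P : Prototiles L) (p : Set (Tile L)) : Prop :=
  p.Pairwise fun s t => Disjoint (interior (supp P s)) (interior (supp P t))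

/-- A patch: non-overlapping tiles with connected union. -/
def IsPatch (P : Prototiles L) (p : Set (Tile L)) : Prop :=
  NonOverlapping P p ∧ IsConnected (⋃ t ∈ p, supp P t)

/-- A tiling of `ℝ`: non-overlapping tiles which cover the line. -/
@[ext]
structure Tiling (P : Prototiles L) where
  tiles : Set (Tile L)
  nonOverlapping : NonOverlapping P tiles
  covers : (⋃ t ∈ tiles, supp P t) = Set.univ

theorem mem_supp_shift (P : Prototiles L) (x y : ℝ) (t : Tile L) :
    y ∈ supp P (t.shift x) ↔ y + x ∈ supp P t := by
  simp only [supp, Tile.shift, Set.mem_Icc]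
  constructor <;> rintro ⟨h1, h2⟩ <;> constructor <;> linarith

theorem mem_interior_supp_shift (P : Prototiles L) (x y : ℝ) (t : Tile L) :
    y ∈ interior (supp P (t.shift x)) ↔ y + x ∈ interior (supp P t) := by
  simp only [supp, Tile.shift, interior_Icc, Set.mem_Ioo]
  constructor <;> rintro ⟨h1, h2⟩ <;> constructor <;> linarith

/-- The translate `T - x` of a tiling. -/
def Tiling.shift {P : Prototiles L} (x : ℝ) (T : Tiling P) : Tiling P where
  tiles := Tile.shift x '' T.tiles
  nonOverlapping := by
    rintro _ ⟨s, hs, rfl⟩ _ ⟨t, ht, rfl⟩ hne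
    rw [Set.disjoint_left]
    intro y hy hy'
    rw [mem_interior_supp_shift] at hy hy'
    have hst : s ≠ t := fun h => hne (by rw [h])
    exact Set.disjoint_left.mp (T.nonOverlapping hs ht hst) hy hy'
  covers := by
    refine Set.eq_univ_of_forall fun y => ?_
    have h : y + x ∈ ⋃ t ∈ T.tiles, supp P t := by rw [T.covers]; trivial
    simp only [Set.mem_iUnion] at h ⊢
    obtain ⟨t, ht, hy⟩ := h
    exact ⟨t.shift x, ⟨t, ht, rfl⟩, (mem_supp_shift P x y t).mpr hy⟩

/-- The distance between two tiles. -/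
def tileDist (P : Prototiles L) (s t : Tile L) : ℝ :=
  max (Metric.hausdorffDist (supp P s) (supp P t)) (dist s.label t.label)

/-- `T` and `T'` have finite patches, each containing the ball of radius `1 / ε` around the origin,
whose tiles can be put in one-to-one correspondence so that corresponding tiles are at distance at
most `ε`. -/
def AgreeWithin {P : Prototiles L} (ε : ℝ) (T T' : Tiling P) : Prop :=
  ∃ p p' : Set (Tile L), p ⊆ T.tiles ∧ p' ⊆ T'.tiles ∧ p.Finite ∧ p'.Finite ∧
    IsPatch P p ∧ IsPatch P p' ∧
    Metric.closedBall (0 : ℝ) (1 / ε) ⊆ (⋃ t ∈ p, supp P t) ∧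
    Metric.closedBall (0 : ℝ) (1 / ε) ⊆ (⋃ t ∈ p', supp P t) ∧
    ∃ e : p ≃ p', ∀ t : p, tileDist P (t : Tile L) (e t : Tile L) ≤ ε

/-- The tiling distance: the least `ε ≤ 1` for which the tilings agree within `ε`, and `1` if there
is no such `ε`. -/
def tilingDist {P : Prototiles L} (T T' : Tiling P) : ℝ :=
  sInf (insert 1 {ε : ℝ | 0 < ε ∧ ε ≤ 1 ∧ AgreeWithin ε T T'})

/-- The topology of the tiling distance: a set is open when it contains, with each of its points,
a ball of positive radius around that point. -/
instance (P : Prototiles L) : TopologicalSpace (Tiling P) where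
  IsOpen U := ∀ T ∈ U, ∃ ε > 0, ∀ T' : Tiling P, tilingDist T T' < ε → T' ∈ U
  isOpen_univ := fun _ _ => ⟨1, one_pos, fun _ _ => trivial⟩
  isOpen_inter := by
    rintro U V hU hV T ⟨hTU, hTV⟩
    obtain ⟨a, ha, hUa⟩ := hU T hTU
    obtain ⟨b, hb, hVb⟩ := hV T hTV
    exact ⟨min a b, lt_min ha hb, fun T' h =>
      ⟨hUa T' (h.trans_le (min_le_left _ _)), hVb T' (h.trans_le (min_le_right _ _))⟩⟩
  isOpen_sUnion := by
    rintro S hS T ⟨U, hU, hTU⟩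
    obtain ⟨a, ha, h⟩ := hS U hU T hTU
    exact ⟨a, ha, fun T' hT' => ⟨U, hU, h T' hT'⟩⟩

/-- A tiling space: a closed, translation-invariant set of tilings by a fixed prototile set. -/
structure IsTilingSpace {P : Prototiles L} (Ω : Set (Tiling P)) : Prop where
  isClosed : IsClosed Ω
  shift_mem : ∀ T ∈ Ω, ∀ x : ℝ, T.shift x ∈ Ω

/-- The two-tile patches occurring in the tilings of `Ω`. -/
def twoTilePatches {P : Prototiles L} (Ω : Set (Tiling P)) : Set (Set (Tile L)) :=
  {p | IsPatch P p ∧ p.ncard = 2 ∧ ∃ T ∈ Ω, p ⊆ T.tiles}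

/-- Finite local complexity: up to translation, only finitely many two-tile patches occur in the
tilings of `Ω`. -/
def HasFLC {P : Prototiles L} (Ω : Set (Tiling P)) : Prop :=
  ∃ F : Set (Set (Tile L)), F.Finite ∧
    ∀ p ∈ twoTilePatches Ω, ∃ q ∈ F, ∃ x : ℝ, p = Tile.shift x '' q

/-- The transversal: the tilings in `Ω` with a control point at the origin. -/
def transversal {P : Prototiles L} (Ω : Set (Tiling P)) : Set (Tiling P) :=
  {T | T ∈ Ω ∧ ∃ t ∈ T.tiles, t.pos = 0}

/-- Strong expansivity: if two tilings of `Ω` stay `ε`-close under the translation flow up to a time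
change fixing `0`, then they are translates of each other by less than `ε`. -/
def StronglyExpansive {P : Prototiles L} (Ω : Set (Tiling P)) : Prop :=
  ∃ ε > 0, ∀ T ∈ Ω, ∀ T' ∈ Ω,
    (∃ h : ℝ ≃ₜ ℝ, h 0 = 0 ∧ ∀ x : ℝ, tilingDist (T.shift x) (T'.shift (h x)) < ε) →
      ∃ x₀ : ℝ, |x₀| < ε ∧ T = T'.shift x₀

end LineTiling

end

/-!
A tiling of the line is a bi-infinite row of tiles, so it is described by a pair `(r, c)`: the
sequence `c : ℤ → L` of its labels, and the parameter `r : ℝ` at which the origin sits, when the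
tile number `i` is parametrized by `[i, i + 1]`.  Two pairs describe the same tiling exactly when
they differ by renumbering, that is, by the action `k +ᵥ (r, c) = (r - k, c (· + k))` of `ℤ`
(`row_eq_row_iff`), and the topology of the tiling distance is the quotient topology
(`isQuotientMap_row`).  So the space of all tilings is a compact Hausdorff space with the covering
space `ℝ × (ℤ → L)`, and a tiling space `Ω` with the set `Y` of label sequences is the mapping torus
of the shift of `Y`, whatever the lengths of the tiles.  Total disconnectedness of the transversal
makes `Y` totally disconnected (`isTotallyDisconnected_sequences`); then paths in `Ω` move along
orbits of the translation flow, with a continuous displacement (`exists_lift`).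

Let `Ω` be homeomorphic to a space `Ω'` with finite local complexity.  Only finitely many labels
occur in `Ω'`, so its label sequences form a totally disconnected set, and small connected sets of
`Ω'` are pieces of orbits.  Hence a small connected set `C` of `Ω`, thickened by short translations,
embeds into an interval, which forces `C` to be a piece of an orbit as well; it meets the
transversal in a countable set (`isTotallyDisconnected_transversal_of_homeomorph`).
Expansivity is transported in the same way: orbits of `Ω` correspond to full orbits of `Ω'`, and two tilings of `Ω'` which stay
close along paths sweeping over them have matching tiles near the origin at all times, up to a small
translation which must then be constant in time
(`Tiling.exists_shift_eq_of_forall_exists`, `stronglyExpansive_of_homeomorph`).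

Conversely let `Ω` be strongly expansive with totally disconnected transversal.  If two sequences in
`Y` have close shifts at all times, then the tilings with these labels are close up to the time
change matching their vertices, so that the sequences are shifts of each other by a bounded amount
(`StronglyExpansive.exists_closed_pairs`).  Symbolic coding by a fine clopen partition of `Y` is
then injective, except on a finite set of sequences whose code is periodic, and a refinement
separates these as well (`exists_injective_code`).  The mapping torus of the coded subshift is `Ω`
on the one hand, and a space of tilings by finitely many types of unit tiles on the other
(`exists_homeomorph_of_code`).
-/

noncomputable section

namespace LineTiling

open Set Filter Topology MeasureTheory

set_option linter.unusedSectionVars false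

/-! ### Arc length along a row of tiles -/

section Arc

variable {L : Type u} [MetricSpace L]

/-- The length of the prototile with label `c`. -/
def Prototiles.len (P : Prototiles L) (c : L) : ℝ := P.right c - P.left c

theorem Prototiles.continuous_len (P : Prototiles L) : Continuous P.len :=
  P.continuous_right.sub P.continuous_left

variable [CompactSpace L]

theorem Prototiles.exists_len_bounds (P : Prototiles L) :
    ∃ δ M : ℝ, 0 < δ ∧ 0 ≤ M ∧ ∀ c, δ ≤ P.len c ∧ P.len c ≤ M := by
  rcases isEmpty_or_nonempty L with h | h
  · exact ⟨1, 1, one_pos, zero_le_one, fun c => (h.false c).elim⟩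
  · obtain ⟨a, -, ha⟩ := isCompact_univ.exists_isMinOn univ_nonempty P.continuous_len.continuousOn
    obtain ⟨b, -, hb⟩ := isCompact_univ.exists_isMaxOn univ_nonempty P.continuous_len.continuousOn
    exact ⟨P.len a, P.len b, sub_pos.2 (P.left_lt_right a), (sub_pos.2 (P.left_lt_right b)).le,
      fun c => ⟨ha (mem_univ c), hb (mem_univ c)⟩⟩

/-- A positive lower bound for the lengths of the prototiles. -/
def Prototiles.minLen (P : Prototiles L) : ℝ := P.exists_len_bounds.choose

/-- An upper bound for the lengths of the prototiles. -/
def Prototiles.maxLen (P : Prototiles L) : ℝ := P.exists_len_bounds.choose_spec.choose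

variable (P : Prototiles L)

theorem Prototiles.minLen_pos : 0 < P.minLen := P.exists_len_bounds.choose_spec.choose_spec.1

theorem Prototiles.maxLen_nonneg : 0 ≤ P.maxLen := P.exists_len_bounds.choose_spec.choose_spec.2.1

theorem Prototiles.minLen_le (c : L) : P.minLen ≤ P.len c :=
  (P.exists_len_bounds.choose_spec.choose_spec.2.2 c).1

theorem Prototiles.le_maxLen (c : L) : P.len c ≤ P.maxLen :=
  (P.exists_len_bounds.choose_spec.choose_spec.2.2 c).2

theorem Prototiles.len_pos (c : L) : 0 < P.len c := P.minLen_pos.trans_le (P.minLen_le c)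

/-- The signed length of the stretch `[a, b]` of a bi-infinite row of tiles with labels `c`, when
the tile number `i` occupies the parameter interval `[i, i + 1]` and is parametrized at constant
speed. -/
def arc (c : ℤ → L) (a b : ℝ) : ℝ := ∫ t in a..b, P.len (c ⌊t⌋)

theorem measurable_len_floor (c : ℤ → L) : Measurable fun t : ℝ => P.len (c ⌊t⌋) :=
  (measurable_from_top (f := fun i : ℤ => P.len (c i))).comp Int.measurable_floor

theorem norm_len_le (c : L) : ‖P.len c‖ ≤ P.maxLen := by
  rw [Real.norm_of_nonneg (P.len_pos c).le]
  exact P.le_maxLen c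

theorem intervalIntegrable_len_floor (c : ℤ → L) (a b : ℝ) :
    IntervalIntegrable (fun t : ℝ => P.len (c ⌊t⌋)) volume a b :=
  (intervalIntegrable_const (c := P.maxLen)).mono_fun
    (measurable_len_floor P c).aestronglyMeasurable
    (Eventually.of_forall fun t => by
      rw [Real.norm_of_nonneg P.maxLen_nonneg]; exact norm_len_le P _)

@[simp]
theorem arc_self (c : ℤ → L) (a : ℝ) : arc P c a a = 0 := intervalIntegral.integral_same

theorem arc_add (c : ℤ → L) (a b d : ℝ) : arc P c a b + arc P c b d = arc P c a d :=
  intervalIntegral.integral_add_adjacent_intervals (intervalIntegrable_len_floor P c a b)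
    (intervalIntegrable_len_floor P c b d)

theorem arc_symm (c : ℤ → L) (a b : ℝ) : arc P c b a = -arc P c a b :=
  intervalIntegral.integral_symm a b

theorem mul_le_arc (c : ℤ → L) {a b : ℝ} (h : a ≤ b) : P.minLen * (b - a) ≤ arc P c a b := by
  have := intervalIntegral.integral_mono (μ := volume) h (intervalIntegrable_const (c := P.minLen))
    (intervalIntegrable_len_floor P c a b) (fun t => P.minLen_le _)
  simpa [arc, mul_comm] using this

theorem mul_abs_le_abs_arc (c : ℤ → L) (a b : ℝ) : P.minLen * |b - a| ≤ |arc P c a b| := by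
  rcases le_total a b with h | h
  · rw [abs_of_nonneg (sub_nonneg.2 h)]
    exact (mul_le_arc P c h).trans (le_abs_self _)
  · rw [abs_sub_comm, abs_of_nonneg (sub_nonneg.2 h), arc_symm, abs_neg]
    exact (mul_le_arc P c h).trans (le_abs_self _)

theorem abs_arc_le (c : ℤ → L) (a b : ℝ) : |arc P c a b| ≤ P.maxLen * |b - a| := by
  rw [← Real.norm_eq_abs]
  exact intervalIntegral.norm_integral_le_of_norm_le_const fun t _ => norm_len_le P _

theorem arc_pos (c : ℤ → L) {a b : ℝ} (h : a < b) : 0 < arc P c a b :=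
  (mul_pos P.minLen_pos (sub_pos.2 h)).trans_le (mul_le_arc P c h.le)

theorem arc_int (c : ℤ → L) (i : ℤ) : arc P c i (i + 1) = P.len (c i) := by
  have h : arc P c i (i + 1) = ∫ _ in (i : ℝ)..(i + 1), P.len (c i) := by
    unfold arc
    rw [intervalIntegral.integral_of_le (by linarith),
      intervalIntegral.integral_of_le (by linarith), integral_Ioc_eq_integral_Ioo, integral_Ioc_eq_integral_Ioo]
    refine setIntegral_congr_fun measurableSet_Ioo fun t ht => ?_
    have : ⌊t⌋ = i := Int.floor_eq_iff.2 ⟨ht.1.le, ht.2⟩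
    simp only [this]
  simpa using h

/-- The labels of a row of tiles, renumbered so that the tile number `k` becomes number `0`. -/
def renumber {L : Type u} (k : ℤ) (c : ℤ → L) : ℤ → L := fun i => c (i + k)

@[simp]
theorem renumber_apply {L : Type u} (k : ℤ) (c : ℤ → L) (i : ℤ) : renumber k c i = c (i + k) := rfl

theorem renumber_renumber {L : Type u} (k l : ℤ) (c : ℤ → L) :
    renumber k (renumber l c) = renumber (k + l) c := by
  ext i; simp [add_assoc]

@[simp]
theorem renumber_zero {L : Type u} (c : ℤ → L) : renumber 0 c = c := by
  ext i; simp

theorem continuous_renumber {L : Type u} [TopologicalSpace L] (k : ℤ) :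
    Continuous (renumber k : (ℤ → L) → ℤ → L) :=
  continuous_pi fun _ => continuous_apply _

theorem arc_renumber (k : ℤ) (c : ℤ → L) (a b : ℝ) :
    arc P (renumber k c) a b = arc P c (a + k) (b + k) := by
  unfold arc
  rw [← intervalIntegral.integral_comp_add_right]
  simp

theorem continuous_arc_labels (a b : ℝ) : Continuous fun c : ℤ → L => arc P c a b :=
  intervalIntegral.continuous_of_dominated_interval (bound := fun _ => P.maxLen)
    (fun c => (measurable_len_floor P c).aestronglyMeasurable)
    (fun _ => Eventually.of_forall fun _ _ => norm_len_le P _) intervalIntegrable_const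
    (Eventually.of_forall fun _ _ => P.continuous_len.comp (continuous_apply _))

/-- Arc length depends jointly continuously on the labels and on the starting point: it is
Lipschitz in the latter, uniformly in the former. -/
theorem continuous_arc (b : ℝ) : Continuous fun x : ℝ × (ℤ → L) => arc P x.2 x.1 b := by
  refine continuous_prod_of_continuous_lipschitzWith _ P.maxLen.toNNReal
    (fun a => continuous_arc_labels P a b) fun c => LipschitzWith.of_dist_le_mul fun x y => ?_
  rw [Real.coe_toNNReal _ P.maxLen_nonneg, Real.dist_eq, Real.dist_eq, abs_sub_comm x y]
  have h := arc_add P c x y b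
  have : arc P c x b - arc P c y b = arc P c x y := by linarith
  rw [this]
  exact abs_arc_le P c x y

theorem arc_right_strictMono (c : ℤ → L) (a : ℝ) : StrictMono fun b => arc P c a b := by
  intro x y hxy
  have := arc_pos P c hxy
  have h := arc_add P c a x y
  simp only
  linarith

theorem continuous_arc_right (c : ℤ → L) (a : ℝ) : Continuous fun b => arc P c a b := by
  have : Continuous fun b : ℝ => -arc P c b a :=
    ((continuous_arc P a).comp (Continuous.prodMk_left c)).neg
  simpa only [← arc_symm] using this

theorem arc_right_surjective (c : ℤ → L) (a : ℝ) : Function.Surjective fun b => arc P c a b := by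
  refine (continuous_arc_right P c a).surjective ?_ ?_
  · refine tendsto_atTop_mono' _ (f₁ := fun b => P.minLen * (b - a)) ?_ ?_
    · filter_upwards [eventually_ge_atTop a] with b hb using mul_le_arc P c hb
    · exact (tendsto_atTop_add_const_right _ _ tendsto_id).const_mul_atTop P.minLen_pos
  · refine tendsto_atBot_mono' _ (f₁ := fun b => P.minLen * (b - a)) ?_ ?_
    · filter_upwards [eventually_le_atBot a] with b hb
      have := mul_le_arc P c hb
      rw [arc_symm] at this
      linarith
    · exact (tendsto_atBot_add_const_right _ _ tendsto_id).const_mul_atBot P.minLen_pos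

/-- Reparametrization of a row of tiles by arc length, measured from `a`. -/
def arcIso (c : ℤ → L) (a : ℝ) : ℝ ≃o ℝ :=
  (arc_right_strictMono P c a).orderIsoOfSurjective _ (arc_right_surjective P c a)

@[simp]
theorem arcIso_apply (c : ℤ → L) (a b : ℝ) : arcIso P c a b = arc P c a b := rfl

end Arc

/-! ### Rows of tiles and tilings -/

section Row

variable {L : Type u} [MetricSpace L]

/-- The left end point of a tile. -/
def Tile.leftEnd (P : Prototiles L) (t : Tile L) : ℝ := t.pos + P.left t.label

/-- The right end point of a tile. -/
def Tile.rightEnd (P : Prototiles L) (t : Tile L) : ℝ := t.pos + P.right t.label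

theorem supp_eq_Icc (P : Prototiles L) (t : Tile L) :
    supp P t = Icc (t.leftEnd P) (t.rightEnd P) := rfl

theorem Tile.rightEnd_eq (P : Prototiles L) (t : Tile L) :
    t.rightEnd P = t.leftEnd P + P.len t.label := by
  simp only [Tile.leftEnd, Tile.rightEnd, Prototiles.len]; ring

theorem Tile.leftEnd_lt_rightEnd (P : Prototiles L) (t : Tile L) :
    t.leftEnd P < t.rightEnd P :=
  add_lt_add_right (P.left_lt_right t.label) _

@[simp]
theorem Tile.shift_label (x : ℝ) (t : Tile L) : (t.shift x).label = t.label := rfl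

@[simp]
theorem Tile.shift_pos (x : ℝ) (t : Tile L) : (t.shift x).pos = t.pos - x := rfl

@[simp]
theorem Tile.leftEnd_shift (P : Prototiles L) (x : ℝ) (t : Tile L) :
    (t.shift x).leftEnd P = t.leftEnd P - x := by
  simp only [Tile.leftEnd, Tile.shift]; ring

@[simp]
theorem Tile.rightEnd_shift (P : Prototiles L) (x : ℝ) (t : Tile L) :
    (t.shift x).rightEnd P = t.rightEnd P - x := by
  simp only [Tile.rightEnd, Tile.shift]; ring

@[simp]
theorem Tile.shift_zero (t : Tile L) : t.shift 0 = t := by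
  ext <;> simp

theorem Tile.shift_shift (x y : ℝ) (t : Tile L) : (t.shift x).shift y = t.shift (x + y) := by
  ext <;> simp [sub_sub]

theorem Tile.ext_leftEnd (P : Prototiles L) {s t : Tile L} (h : s.leftEnd P = t.leftEnd P)
    (hl : s.label = t.label) : s = t := by
  refine Tile.ext ?_ hl
  simp only [Tile.leftEnd, hl] at h
  linarith

@[simp]
theorem Tiling.shift_zero {P : Prototiles L} (T : Tiling P) : T.shift 0 = T := by
  ext t
  simp [Tiling.shift]

theorem Tiling.shift_shift {P : Prototiles L} (x y : ℝ) (T : Tiling P) :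
    (T.shift x).shift y = T.shift (x + y) := by
  ext t
  simp [Tiling.shift, Tile.shift_shift]

theorem Tiling.mem_shift {P : Prototiles L} {x : ℝ} {T : Tiling P} {t : Tile L} :
    t ∈ (T.shift x).tiles ↔ t.shift (-x) ∈ T.tiles := by
  constructor
  · rintro ⟨s, hs, rfl⟩
    simpa [Tile.shift_shift] using hs
  · intro h
    exact ⟨_, h, by simp [Tile.shift_shift]⟩

/-- Of two distinct tiles of a tiling, one lies to the left of the other. -/
theorem Tiling.eq_or_rightEnd_le {P : Prototiles L} (T : Tiling P) {s t : Tile L}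
    (hs : s ∈ T.tiles) (ht : t ∈ T.tiles) :
    s = t ∨ s.rightEnd P ≤ t.leftEnd P ∨ t.rightEnd P ≤ s.leftEnd P := by
  by_contra! hcon
  have hd : Disjoint (interior (supp P s)) (interior (supp P t)) :=
    T.nonOverlapping hs ht hcon.1
  rw [supp_eq_Icc, supp_eq_Icc, interior_Icc, interior_Icc, Ioo_disjoint_Ioo] at hd
  have := t.leftEnd_lt_rightEnd P
  have := s.leftEnd_lt_rightEnd P
  rcases min_le_iff.1 hd with h | h <;> rcases le_max_iff.1 h with h' | h' <;> linarith

theorem Tiling.exists_mem {P : Prototiles L} (T : Tiling P) (y : ℝ) :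
    ∃ t ∈ T.tiles, t.leftEnd P ≤ y ∧ y ≤ t.rightEnd P := by
  have h : y ∈ ⋃ t ∈ T.tiles, supp P t := by rw [T.covers]; trivial
  simpa only [supp_eq_Icc, mem_iUnion, exists_prop, mem_Icc] using h

variable [CompactSpace L] (P : Prototiles L)

theorem Tile.add_minLen_le (t : Tile L) : t.leftEnd P + P.minLen ≤ t.rightEnd P := by
  rw [t.rightEnd_eq]
  linarith [P.minLen_le t.label]

/-- The left end point of the tile number `i` in the tiling described by `x = (r, c)`: the tiles
have the labels `c`, and the origin sits at the parameter `r` of the row of tiles. -/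
def vert (x : ℝ × (ℤ → L)) (i : ℤ) : ℝ := arc P x.2 x.1 i

/-- The tile number `i` in the tiling described by `x`. -/
def tileAt (x : ℝ × (ℤ → L)) (i : ℤ) : Tile L := ⟨vert P x i - P.left (x.2 i), x.2 i⟩

@[simp]
theorem tileAt_label (x : ℝ × (ℤ → L)) (i : ℤ) : (tileAt P x i).label = x.2 i := rfl

@[simp]
theorem tileAt_leftEnd (x : ℝ × (ℤ → L)) (i : ℤ) : (tileAt P x i).leftEnd P = vert P x i := by
  simp [tileAt, Tile.leftEnd]

theorem vert_add_one (x : ℝ × (ℤ → L)) (i : ℤ) :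
    vert P x (i + 1) = vert P x i + P.len (x.2 i) := by
  rw [← arc_int, vert, vert, Int.cast_add, Int.cast_one, arc_add]

@[simp]
theorem tileAt_rightEnd (x : ℝ × (ℤ → L)) (i : ℤ) :
    (tileAt P x i).rightEnd P = vert P x (i + 1) := by
  rw [Tile.rightEnd_eq, vert_add_one, tileAt_leftEnd, tileAt_label]

theorem vert_strictMono (x : ℝ × (ℤ → L)) : StrictMono (vert P x) :=
  (arc_right_strictMono P x.2 x.1).comp Int.cast_strictMono

theorem exists_vert_le_lt (x : ℝ × (ℤ → L)) (y : ℝ) :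
    ∃ i, vert P x i ≤ y ∧ y < vert P x (i + 1) := by
  obtain ⟨b, rfl⟩ := arc_right_surjective P x.2 x.1 y
  refine ⟨⌊b⌋, (arc_right_strictMono P x.2 x.1).monotone (Int.floor_le b), ?_⟩
  refine arc_right_strictMono P x.2 x.1 ?_
  simp [Int.lt_floor_add_one b]

theorem vert_lt_iff (x : ℝ × (ℤ → L)) {i j : ℤ} : vert P x i < vert P x j ↔ i < j :=
  (vert_strictMono P x).lt_iff_lt

theorem vert_le_iff (x : ℝ × (ℤ → L)) {i j : ℤ} : vert P x i ≤ vert P x j ↔ i ≤ j :=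
  (vert_strictMono P x).le_iff_le

theorem vert_add_minLen_le (x : ℝ × (ℤ → L)) {i j : ℤ} (h : i < j) :
    vert P x i + P.minLen ≤ vert P x j := by
  have h1 := (vert_le_iff P x).2 (Int.add_one_le_of_lt h)
  rw [vert_add_one] at h1
  linarith [P.minLen_le (x.2 i)]

/-- Vertices which are closer than the shortest tile coincide. -/
theorem eq_of_abs_vert_sub_lt (x : ℝ × (ℤ → L)) {i j : ℤ}
    (h : |vert P x i - vert P x j| < P.minLen) : i = j := by
  rw [abs_lt] at h
  rcases lt_trichotomy i j with hij | hij | hij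
  · linarith [vert_add_minLen_le P x hij]
  · exact hij
  · linarith [vert_add_minLen_le P x hij]

theorem tileAt_injective (x : ℝ × (ℤ → L)) : Function.Injective (tileAt P x) := fun i j h =>
  (vert_strictMono P x).injective (by rw [← tileAt_leftEnd, h, tileAt_leftEnd])

/-- The tiling described by `x = (r, c)`: a bi-infinite row of tiles with labels `c` which has the
origin at the parameter `r`. -/
def row (x : ℝ × (ℤ → L)) : Tiling P where
  tiles := range (tileAt P x)
  nonOverlapping := by
    rintro _ ⟨i, rfl⟩ _ ⟨j, rfl⟩ hne
    rw [supp_eq_Icc, supp_eq_Icc, interior_Icc, interior_Icc, Ioo_disjoint_Ioo]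
    simp only [tileAt_leftEnd, tileAt_rightEnd]
    have hij : i ≠ j := fun h => hne (by rw [h])
    rcases lt_or_gt_of_ne hij with h | h
    · exact (min_le_left _ _).trans (le_max_of_le_right ((vert_le_iff P x).2 h))
    · exact (min_le_right _ _).trans (le_max_of_le_left ((vert_le_iff P x).2 h))
  covers := by
    refine eq_univ_of_forall fun y => ?_
    obtain ⟨i, h1, h2⟩ := exists_vert_le_lt P x y
    simp only [mem_iUnion]
    refine ⟨_, ⟨i, rfl⟩, ?_⟩
    rw [supp_eq_Icc]
    simp [h1, h2.le]

@[simp]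
theorem row_tiles (x : ℝ × (ℤ → L)) : (row P x).tiles = range (tileAt P x) := rfl

/-- The integers act on the descriptions of tilings by renumbering the tiles: the tile number `k`
becomes number `0`, which moves the parameter of the origin by `-k`. -/
instance : AddAction ℤ (ℝ × (ℤ → L)) where
  vadd k x := (x.1 - k, renumber k x.2)
  zero_vadd x := by
    change (x.1 - ((0 : ℤ) : ℝ), renumber 0 x.2) = x
    simp
  add_vadd k l x := by
    change (x.1 - ((k + l : ℤ) : ℝ), renumber (k + l) x.2)
      = (x.1 - (l : ℝ) - (k : ℝ), renumber k (renumber l x.2))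
    rw [renumber_renumber]
    push_cast
    congr 1
    ring

omit [MetricSpace L] [CompactSpace L] in
theorem vadd_def (k : ℤ) (x : ℝ × (ℤ → L)) : k +ᵥ x = (x.1 - k, renumber k x.2) := rfl

theorem vert_vadd (k : ℤ) (x : ℝ × (ℤ → L)) (i : ℤ) : vert P (k +ᵥ x) i = vert P x (i + k) := by
  simp [vert, vadd_def, arc_renumber]

theorem tileAt_vadd (k : ℤ) (x : ℝ × (ℤ → L)) (i : ℤ) :
    tileAt P (k +ᵥ x) i = tileAt P x (i + k) := by
  simp only [tileAt, vert_vadd]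
  rfl

theorem row_vadd (k : ℤ) (x : ℝ × (ℤ → L)) : row P (k +ᵥ x) = row P x := by
  ext t
  simp only [row_tiles, mem_range, tileAt_vadd]
  exact ⟨fun ⟨i, h⟩ => ⟨_, h⟩, fun ⟨i, h⟩ => ⟨i - k, by simpa using h⟩⟩

/-- The description of a tiling is determined by the choice of the tile number `0`: its neighbours
are found from there one by one. -/
theorem eq_of_tileAt_eq {x y : ℝ × (ℤ → L)} (h : row P x = row P y)
    (h0 : tileAt P x 0 = tileAt P y 0) : x = y := by
  have hmem : ∀ i, ∃ j, tileAt P y j = tileAt P x i := fun i => by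
    have : tileAt P x i ∈ (row P y).tiles := by rw [← h]; exact ⟨i, rfl⟩
    exact this
  have hv : ∀ i, tileAt P x i = tileAt P y i := by
    intro i
    induction i with
    | zero => exact h0
    | succ i ih =>
      obtain ⟨j, hj⟩ := hmem (i + 1)
      have h1 : vert P y j = vert P y (i + 1) := by
        rw [← tileAt_leftEnd P y j, hj, tileAt_leftEnd, ← tileAt_rightEnd, ih, tileAt_rightEnd]
      rw [← hj, (vert_strictMono P y).injective h1]
    | pred i ih =>
      obtain ⟨j, hj⟩ := hmem (-i - 1)
      have h1 : vert P y (j + 1) = vert P y (-i - 1 + 1) := by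
        rw [← tileAt_rightEnd P y j, hj, tileAt_rightEnd]
        simp only [sub_add_cancel]
        rw [← tileAt_leftEnd, ih, tileAt_leftEnd]
      rw [← hj, add_right_cancel ((vert_strictMono P y).injective h1)]
  have hc : x.2 = y.2 := funext fun i => by rw [← tileAt_label P x, hv, tileAt_label]
  refine Prod.ext ?_ hc
  have h1 : vert P x 0 = vert P y 0 := by rw [← tileAt_leftEnd, h0, tileAt_leftEnd]
  have h2 : arc P x.2 0 x.1 = arc P x.2 0 y.1 := by
    rw [vert, vert, ← hc] at h1
    rw [arc_symm, arc_symm P _ y.1]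
    simpa using h1
  exact (arc_right_strictMono P x.2 0).injective h2

/-- Two descriptions give the same tiling exactly when they differ by renumbering. -/
theorem row_eq_row_iff {x y : ℝ × (ℤ → L)} : row P x = row P y ↔ ∃ k : ℤ, k +ᵥ y = x := by
  constructor
  · intro h
    have : tileAt P x 0 ∈ (row P y).tiles := by rw [← h]; exact ⟨0, rfl⟩
    obtain ⟨k, hk⟩ := this
    refine ⟨k, (eq_of_tileAt_eq P (by rw [row_vadd, h]) ?_).symm⟩
    rw [tileAt_vadd, zero_add, hk]
  · rintro ⟨k, rfl⟩
    rw [row_vadd]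

theorem row_shift (r r' : ℝ) (c : ℤ → L) :
    (row P (r, c)).shift (arc P c r r') = row P (r', c) := by
  ext t
  rw [Tiling.mem_shift]
  simp only [row_tiles, mem_range]
  refine exists_congr fun i => ?_
  have h : vert P (r, c) i = vert P (r', c) i + arc P c r r' := by
    simp only [vert]; rw [← arc_add P c r r' i]; ring
  constructor
  · intro h'
    have : t = (tileAt P (r, c) i).shift (arc P c r r') := by rw [h', Tile.shift_shift]; simp
    rw [this]
    ext
    · simp only [tileAt, Tile.shift, h]; ring
    · rfl
  · rintro rfl
    ext
    · simp only [tileAt, Tile.shift, h]; ring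
    · rfl

theorem exists_row_shift (r x : ℝ) (c : ℤ → L) :
    ∃ r', arc P c r r' = x ∧ (row P (r, c)).shift x = row P (r', c) := by
  obtain ⟨r', rfl⟩ := arc_right_surjective P c r x
  exact ⟨r', rfl, row_shift P r r' c⟩

/-- In a tiling every tile is followed by another one: a gap to its right could not be filled. -/
theorem Tiling.exists_next {P : Prototiles L} (T : Tiling P) {t : Tile L} (ht : t ∈ T.tiles) :
    ∃ s ∈ T.tiles, s.leftEnd P = t.rightEnd P := by
  have hδ := P.minLen_pos
  have htl := t.add_minLen_le P
  obtain ⟨s, hs, h1, h2⟩ := T.exists_mem (t.rightEnd P + P.minLen / 2)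
  have hsl := s.add_minLen_le P
  rcases T.eq_or_rightEnd_le hs ht with rfl | h | h
  · linarith
  · linarith
  refine ⟨s, hs, h.antisymm' ?_⟩
  by_contra! hlt
  obtain ⟨w, hw, h3, h4⟩ := T.exists_mem ((t.rightEnd P + s.leftEnd P) / 2)
  have hwl := w.add_minLen_le P
  rcases T.eq_or_rightEnd_le hs hw with rfl | h5 | h5
  · linarith
  · linarith
  · rcases T.eq_or_rightEnd_le ht hw with rfl | h6 | h6 <;> linarith

theorem Tiling.exists_prev {P : Prototiles L} (T : Tiling P) {t : Tile L} (ht : t ∈ T.tiles) :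
    ∃ s ∈ T.tiles, s.rightEnd P = t.leftEnd P := by
  have hδ := P.minLen_pos
  have htl := t.add_minLen_le P
  obtain ⟨s, hs, h1, h2⟩ := T.exists_mem (t.leftEnd P - P.minLen / 2)
  have hsl := s.add_minLen_le P
  rcases T.eq_or_rightEnd_le hs ht with rfl | h | h
  · linarith
  · refine ⟨s, hs, h.antisymm ?_⟩
    by_contra! hlt
    obtain ⟨w, hw, h3, h4⟩ := T.exists_mem ((s.rightEnd P + t.leftEnd P) / 2)
    have hwl := w.add_minLen_le P
    rcases T.eq_or_rightEnd_le hs hw with rfl | h5 | h5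
    · linarith
    · rcases T.eq_or_rightEnd_le ht hw with rfl | h6 | h6 <;> linarith
    · linarith
  · linarith

theorem Tiling.eq_of_leftEnd_eq {P : Prototiles L} (T : Tiling P) {s t : Tile L}
    (hs : s ∈ T.tiles) (ht : t ∈ T.tiles) (h : s.leftEnd P = t.leftEnd P) : s = t := by
  have hsl := s.leftEnd_lt_rightEnd P
  have htl := t.leftEnd_lt_rightEnd P
  rcases T.eq_or_rightEnd_le hs ht with rfl | h | h
  · rfl
  · linarith
  · linarith

/-- Every tiling is a row of tiles: starting from any tile, number the tiles by following their
neighbours. -/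
theorem row_surjective : Function.Surjective (row P) := by
  intro T
  obtain ⟨t₀, ht₀, -⟩ := T.exists_mem 0
  choose nx hnx hnx' using fun t : T.tiles => T.exists_next t.2
  choose pv hpv hpv' using fun t : T.tiles => T.exists_prev t.2
  have inv1 : ∀ t : T.tiles, pv ⟨nx t, hnx t⟩ = t := by
    intro t
    refine T.eq_of_leftEnd_eq (hpv _) t.2 ?_
    have h := hpv' ⟨nx t, hnx t⟩
    rcases T.eq_or_rightEnd_le (hpv ⟨nx t, hnx t⟩) t.2 with h1 | h1 | h1
    · rw [h1]
    · have := (pv ⟨nx t, hnx t⟩).leftEnd_lt_rightEnd P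
      have := t.1.leftEnd_lt_rightEnd P
      have := hnx' t
      linarith
    · have := (pv ⟨nx t, hnx t⟩).leftEnd_lt_rightEnd P
      have := hnx' t
      linarith
  have inv2 : ∀ t : T.tiles, nx ⟨pv t, hpv t⟩ = t := fun t =>
    T.eq_of_leftEnd_eq (hnx _) t.2 (by rw [hnx' ⟨pv t, hpv t⟩]; exact hpv' t)
  let e : Equiv.Perm T.tiles :=
    { toFun := fun t => ⟨nx t, hnx t⟩
      invFun := fun t => ⟨pv t, hpv t⟩
      left_inv := fun t => Subtype.ext (inv1 t)
      right_inv := fun t => Subtype.ext (inv2 t) }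
  let τ : ℤ → T.tiles := fun i => (e ^ i) ⟨t₀, ht₀⟩
  have hτ : ∀ i, (τ (i + 1)).1.leftEnd P = (τ i).1.rightEnd P := by
    intro i
    have : τ (i + 1) = e (τ i) := by
      simp only [τ]; rw [add_comm, zpow_add, zpow_one, Equiv.Perm.mul_apply]
    rw [this]
    exact hnx' (τ i)
  let c : ℤ → L := fun i => (τ i).1.label
  obtain ⟨r, hr⟩ := arc_right_surjective P c 0 (-(t₀.leftEnd P))
  have hv : ∀ i, vert P (r, c) i = (τ i).1.leftEnd P := by
    intro i
    induction i with
    | zero =>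
      have : τ 0 = ⟨t₀, ht₀⟩ := rfl
      rw [this, vert, arc_symm]
      simp only at hr
      simp [hr]
    | succ i ih => rw [hτ, vert_add_one, ih, Tile.rightEnd_eq]
    | pred i ih =>
      have h1 := vert_add_one P (r, c) (-i - 1)
      have h2 := hτ (-i - 1)
      rw [sub_add_cancel] at h1 h2
      rw [Tile.rightEnd_eq] at h2
      have : P.len ((r, c).2 (-i - 1)) = P.len (τ (-i - 1)).1.label := rfl
      linarith
  have ht : ∀ i, tileAt P (r, c) i = τ i := fun i =>
    Tile.ext_leftEnd P (by rw [tileAt_leftEnd, hv]) rfl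
  refine ⟨(r, c), Tiling.ext (Subset.antisymm ?_ ?_)⟩
  · rintro _ ⟨i, rfl⟩
    rw [ht]
    exact (τ i).2
  · intro s hs
    obtain ⟨i, h1, h2⟩ := exists_vert_le_lt P (r, c) ((s.leftEnd P + s.rightEnd P) / 2)
    have hsl := s.leftEnd_lt_rightEnd P
    refine ⟨i, ?_⟩
    have hmem : tileAt P (r, c) i ∈ T.tiles := by rw [ht]; exact (τ i).2
    rw [← tileAt_leftEnd] at h1
    rw [← tileAt_rightEnd] at h2
    rcases T.eq_or_rightEnd_le hmem hs with h | h | h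
    · exact h
    · linarith
    · linarith

end Row

/-! ### The tiling distance in terms of rows of tiles -/

section Distance

theorem abs_sub_le_hausdorffDist_Icc_left {a b c d : ℝ} (hab : a ≤ b) (hcd : c ≤ d) :
    |a - c| ≤ Metric.hausdorffDist (Icc a b) (Icc c d) := by
  have key : ∀ {a b c d : ℝ}, a ≤ b → c ≤ d → c - a ≤ Metric.hausdorffDist (Icc a b) (Icc c d) := by
    intro a b c d hab hcd
    have hfin := Metric.hausdorffEDist_ne_top_of_nonempty_of_bounded (nonempty_Icc.2 hab)
      (nonempty_Icc.2 hcd) (Metric.isBounded_Icc a b) (Metric.isBounded_Icc c d)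
    refine le_trans ?_ (Metric.infDist_le_hausdorffDist_of_mem (left_mem_Icc.2 hab) hfin)
    refine (Metric.le_infDist (nonempty_Icc.2 hcd)).2 fun y hy => ?_
    rw [Real.dist_eq, abs_sub_comm]
    exact (sub_le_sub_right hy.1 a).trans (le_abs_self _)
  rw [abs_le]
  refine ⟨by linarith [key hab hcd], ?_⟩
  rw [Metric.hausdorffDist_comm]
  exact key hcd hab

theorem abs_sub_le_hausdorffDist_Icc_right {a b c d : ℝ} (hab : a ≤ b) (hcd : c ≤ d) :
    |b - d| ≤ Metric.hausdorffDist (Icc a b) (Icc c d) := by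
  have key : ∀ {a b c d : ℝ}, a ≤ b → c ≤ d → b - d ≤ Metric.hausdorffDist (Icc a b) (Icc c d) := by
    intro a b c d hab hcd
    have hfin := Metric.hausdorffEDist_ne_top_of_nonempty_of_bounded (nonempty_Icc.2 hab)
      (nonempty_Icc.2 hcd) (Metric.isBounded_Icc a b) (Metric.isBounded_Icc c d)
    refine le_trans ?_ (Metric.infDist_le_hausdorffDist_of_mem (right_mem_Icc.2 hab) hfin)
    refine (Metric.le_infDist (nonempty_Icc.2 hcd)).2 fun y hy => ?_
    rw [Real.dist_eq]
    exact (sub_le_sub_left hy.2 b).trans (le_abs_self _)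
  rw [abs_le]
  refine ⟨?_, key hab hcd⟩
  rw [Metric.hausdorffDist_comm]
  linarith [key hcd hab]

theorem hausdorffDist_Icc_le {a b c d ε : ℝ} (hab : a ≤ b) (hcd : c ≤ d) (h1 : |a - c| ≤ ε)
    (h2 : |b - d| ≤ ε) : Metric.hausdorffDist (Icc a b) (Icc c d) ≤ ε := by
  have key : ∀ {a b c d : ℝ}, c ≤ d → |a - c| ≤ ε → |b - d| ≤ ε →
      ∀ x ∈ Icc a b, ∃ y ∈ Icc c d, dist x y ≤ ε := by
    intro a b c d hcd h1 h2 x hx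
    rw [abs_le] at h1 h2
    refine ⟨max c (min x d), ⟨le_max_left _ _, max_le hcd (min_le_right _ _)⟩, ?_⟩
    rw [Real.dist_eq, abs_le]
    obtain ⟨hx1, hx2⟩ := hx
    rcases le_total x d with h | h
    · rw [min_eq_left h]
      rcases le_total c x with h' | h'
      · rw [max_eq_right h']; constructor <;> linarith
      · rw [max_eq_left h']; constructor <;> linarith
    · rw [min_eq_right h, max_eq_right hcd]; constructor <;> linarith
  refine Metric.hausdorffDist_le_of_mem_dist ((abs_nonneg _).trans h1) (key hcd h1 h2) ?_
  rw [abs_sub_comm] at h1 h2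
  exact key hab h1 h2

variable {L : Type u} [MetricSpace L]

theorem abs_leftEnd_sub_le_tileDist (P : Prototiles L) (s t : Tile L) :
    |s.leftEnd P - t.leftEnd P| ≤ tileDist P s t :=
  (abs_sub_le_hausdorffDist_Icc_left (s.leftEnd_lt_rightEnd P).le
    (t.leftEnd_lt_rightEnd P).le).trans (le_max_left _ _)

theorem abs_rightEnd_sub_le_tileDist (P : Prototiles L) (s t : Tile L) :
    |s.rightEnd P - t.rightEnd P| ≤ tileDist P s t :=
  (abs_sub_le_hausdorffDist_Icc_right (s.leftEnd_lt_rightEnd P).le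
    (t.leftEnd_lt_rightEnd P).le).trans (le_max_left _ _)

theorem dist_label_le_tileDist (P : Prototiles L) (s t : Tile L) :
    dist s.label t.label ≤ tileDist P s t := le_max_right _ _

theorem tileDist_le {P : Prototiles L} {s t : Tile L} {ε : ℝ}
    (h1 : |s.leftEnd P - t.leftEnd P| ≤ ε) (h2 : |s.rightEnd P - t.rightEnd P| ≤ ε)
    (h3 : dist s.label t.label ≤ ε) : tileDist P s t ≤ ε :=
  max_le (hausdorffDist_Icc_le (s.leftEnd_lt_rightEnd P).le (t.leftEnd_lt_rightEnd P).le h1 h2) h3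

theorem tilingDist_le_of_agreeWithin {P : Prototiles L} {T T' : Tiling P} {ε : ℝ} (h0 : 0 < ε)
    (h1 : ε ≤ 1) (h : AgreeWithin ε T T') : tilingDist T T' ≤ ε := by
  refine csInf_le ⟨0, ?_⟩ (mem_insert_of_mem _ ⟨h0, h1, h⟩)
  rintro _ (rfl | ⟨h, -⟩)
  · exact zero_le_one
  · exact h.le

theorem exists_agreeWithin_of_tilingDist_lt {P : Prototiles L} {T T' : Tiling P} {γ : ℝ}
    (h1 : γ ≤ 1) (h : tilingDist T T' < γ) : ∃ ε, 0 < ε ∧ ε < γ ∧ AgreeWithin ε T T' := by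
  obtain ⟨ε, rfl | ⟨h0, -, hε⟩, hlt⟩ := exists_lt_of_csInf_lt (insert_nonempty _ _) h
  · linarith
  · exact ⟨ε, h0, hlt, hε⟩

/-- A tile of a tiling which meets the ball of radius `1 / ε` in its interior has a partner at
distance at most `ε` in every tiling agreeing with the given one within `ε`. -/
theorem AgreeWithin.exists_partner {P : Prototiles L} {T T' : Tiling P} {ε : ℝ}
    (h : AgreeWithin ε T T') : ∃ f : Tile L → Tile L, ∀ t ∈ T.tiles, ∀ y, t.leftEnd P < y →
      y < t.rightEnd P → |y| ≤ 1 / ε → f t ∈ T'.tiles ∧ tileDist P t (f t) ≤ ε := by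
  classical
  obtain ⟨p, p', hp, hp', -, -, -, -, hb, -, e, he⟩ := h
  refine ⟨fun t => if ht : t ∈ p then e ⟨t, ht⟩ else t, fun t ht y h1 h2 hy => ?_⟩
  have hmem : t ∈ p := by
    have hy' : y ∈ ⋃ t ∈ p, supp P t := hb (by simpa using hy)
    simp only [mem_iUnion, exists_prop] at hy'
    obtain ⟨s, hs, hys⟩ := hy'
    have : t = s := by
      have hys : s.leftEnd P ≤ y ∧ y ≤ s.rightEnd P := hys
      rcases T.eq_or_rightEnd_le ht (hp hs) with h | h | h
      · exact h
      · linarith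
      · linarith
    rwa [this]
  simp only [dif_pos hmem]
  exact ⟨hp' (e ⟨t, hmem⟩).2, he ⟨t, hmem⟩⟩

variable [CompactSpace L] (P : Prototiles L)

theorem iUnion_supp_tileAt (x : ℝ × (ℤ → L)) {a b : ℤ} (hab : a ≤ b) :
    ⋃ t ∈ tileAt P x '' Icc a b, supp P t = Icc (vert P x a) (vert P x (b + 1)) := by
  ext y
  simp only [biUnion_image, mem_iUnion, exists_prop, supp_eq_Icc, tileAt_leftEnd, tileAt_rightEnd,
    mem_Icc]
  constructor
  · rintro ⟨i, ⟨h1, h2⟩, h3, h4⟩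
    exact ⟨((vert_le_iff P x).2 h1).trans h3, h4.trans ((vert_le_iff P x).2 (by omega))⟩
  · rintro ⟨h1, h2⟩
    obtain ⟨i, h3, h4⟩ := exists_vert_le_lt P x y
    rcases h2.lt_or_eq with h2 | rfl
    · have h5 := (vert_lt_iff P x).1 (h1.trans_lt h4)
      have h6 := (vert_lt_iff P x).1 (h3.trans_lt h2)
      exact ⟨i, ⟨by omega, by omega⟩, h3, h4.le⟩
    · exact ⟨b, ⟨hab, le_rfl⟩, (vert_le_iff P x).2 (by omega), le_rfl⟩

theorem isPatch_tileAt_image (x : ℝ × (ℤ → L)) {a b : ℤ} (hab : a ≤ b) :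
    IsPatch P (tileAt P x '' Icc a b) := by
  refine ⟨(row P x).nonOverlapping.mono (image_subset_range _ _), ?_⟩
  rw [iUnion_supp_tileAt P x hab]
  exact isConnected_Icc ((vert_le_iff P x).2 (by omega))

theorem agreeWithin_row {x y : ℝ × (ℤ → L)} {n : ℕ} {η : ℝ}
    (hx : vert P x (-n) ≤ -(1 / η) ∧ 1 / η ≤ vert P x (n + 1))
    (hy : vert P y (-n) ≤ -(1 / η) ∧ 1 / η ≤ vert P y (n + 1))
    (hv : ∀ i ∈ Icc (-n : ℤ) (n + 1), |vert P x i - vert P y i| ≤ η)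
    (hl : ∀ i ∈ Icc (-n : ℤ) (n + 1), dist (x.2 i) (y.2 i) ≤ η) :
    AgreeWithin η (row P x) (row P y) := by
  have hn : (-n : ℤ) ≤ n := by omega
  refine ⟨tileAt P x '' Icc (-n : ℤ) n, tileAt P y '' Icc (-n : ℤ) n, image_subset_range _ _,
    image_subset_range _ _, (finite_Icc _ _).image _, (finite_Icc _ _).image _,
    isPatch_tileAt_image P x hn, isPatch_tileAt_image P y hn, ?_, ?_,
    (Equiv.Set.image _ _ (tileAt_injective P x)).symm.trans
      (Equiv.Set.image _ _ (tileAt_injective P y)), ?_⟩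
  · rw [iUnion_supp_tileAt P x hn, Real.closedBall_eq_Icc]
    exact Icc_subset_Icc (by linarith) (by linarith)
  · rw [iUnion_supp_tileAt P y hn, Real.closedBall_eq_Icc]
    exact Icc_subset_Icc (by linarith) (by linarith)
  · rintro ⟨_, ⟨i, hi, rfl⟩⟩
    have : (Equiv.Set.image _ (Icc (-n : ℤ) n) (tileAt_injective P x)).symm
        ⟨tileAt P x i, ⟨i, hi, rfl⟩⟩ = ⟨i, hi⟩ := by
      rw [Equiv.symm_apply_eq]; rfl
    rw [Equiv.trans_apply, this]
    simp only [Equiv.Set.image_apply]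
    rw [mem_Icc] at hi
    refine tileDist_le ?_ ?_ ?_
    · simpa using hv i ⟨hi.1, by omega⟩
    · simpa using hv (i + 1) ⟨by omega, by omega⟩
    · simpa using hl i ⟨hi.1, by omega⟩

theorem continuous_vert (i : ℤ) : Continuous fun x => vert P x i := continuous_arc P i

/-- Tilings with neighbouring descriptions are close. -/
theorem eventually_tilingDist_row_lt (x₀ : ℝ × (ℤ → L)) {ε : ℝ} (hε : 0 < ε) :
    ∀ᶠ z in 𝓝 x₀ ×ˢ 𝓝 x₀, tilingDist (row P z.1) (row P z.2) < ε := by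
  set η := min (ε / 2) 1 with hη
  have hη0 : 0 < η := lt_min (half_pos hε) one_pos
  have hbot : ∃ n : ℕ, vert P x₀ (-n) < -(1 / η) ∧ 1 / η < vert P x₀ (n + 1) := by
    obtain ⟨a, ha⟩ := arc_right_surjective P x₀.2 x₀.1 (-(1 / η))
    obtain ⟨b, hb⟩ := arc_right_surjective P x₀.2 x₀.1 (1 / η)
    obtain ⟨n, hn⟩ := exists_nat_gt (max (-a) b)
    rw [max_lt_iff] at hn
    refine ⟨n, ?_, ?_⟩
    · rw [← ha]
      exact arc_right_strictMono P x₀.2 x₀.1 (by push_cast; linarith)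
    · rw [← hb]
      exact arc_right_strictMono P x₀.2 x₀.1 (by push_cast; linarith)
  obtain ⟨n, hn1, hn2⟩ := hbot
  have h1 : ∀ᶠ x in 𝓝 x₀, vert P x (-n) ≤ -(1 / η) ∧ 1 / η ≤ vert P x (n + 1) := by
    filter_upwards [(continuous_vert P (-n)).continuousAt.eventually_lt_const hn1,
      (continuous_vert P (n + 1)).continuousAt.eventually_const_lt hn2] with x h1 h2
    exact ⟨h1.le, h2.le⟩
  have h2 : ∀ᶠ x in 𝓝 x₀, ∀ i ∈ Icc (-n : ℤ) (n + 1),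
      dist (vert P x i) (vert P x₀ i) < η / 2 ∧ dist (x.2 i) (x₀.2 i) < η / 2 := by
    refine (eventually_all_finite (finite_Icc _ _)).2 fun i _ => ?_
    refine (Metric.continuousAt_iff'.1 (continuous_vert P i).continuousAt _ (half_pos hη0)).and ?_
    exact Metric.continuousAt_iff'.1
      ((continuous_apply i).comp continuous_snd).continuousAt _ (half_pos hη0)
  filter_upwards [(h1.and h2).prod_mk (h1.and h2)] with z hz
  obtain ⟨⟨hz1, hz2⟩, hz3, hz4⟩ := hz
  refine (tilingDist_le_of_agreeWithin hη0 (min_le_right _ _) (agreeWithin_row P hz1 hz3 ?_ ?_)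
    ).trans_lt ((min_le_left _ _).trans_lt (half_lt_self hε))
  · intro i hi
    rw [← Real.dist_eq]
    linarith [dist_triangle_right (vert P z.1 i) (vert P z.2 i) (vert P x₀ i), (hz2 i hi).1,
      (hz4 i hi).1]
  · intro i hi
    linarith [dist_triangle_right (z.1.2 i) (z.2.2 i) (x₀.2 i), (hz2 i hi).2, (hz4 i hi).2]

/-- If a tiling is close to the one described by `x`, then it has a description whose tiles match
those of `x` number by number, as long as these lie in the relevant ball. -/
theorem exists_row_eq_of_tilingDist_lt {x : ℝ × (ℤ → L)} {T : Tiling P} {γ : ℝ} (hγ1 : γ ≤ 1)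
    (hγ : 2 * γ < P.minLen) (h : tilingDist (row P x) T < γ)
    (h0 : -(1 / γ) ≤ vert P x 0) (h1 : vert P x 1 ≤ 1 / γ) :
    ∃ y, row P y = T ∧ ∀ n : ℕ, -(1 / γ) ≤ vert P x (-n) → vert P x (n + 1) ≤ 1 / γ →
      ∀ i ∈ Icc (-n : ℤ) n, |vert P x i - vert P y i| ≤ γ ∧ dist (x.2 i) (y.2 i) ≤ γ := by
  obtain ⟨ε, hε0, hεγ, hε⟩ := exists_agreeWithin_of_tilingDist_lt hγ1 h
  obtain ⟨f, hf⟩ := hε.exists_partner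
  obtain ⟨y', rfl⟩ := row_surjective P T
  have hball : 1 / γ ≤ 1 / ε := one_div_le_one_div_of_le hε0 hεγ.le
  have key : ∀ i, -(1 / γ) ≤ vert P x i → vert P x (i + 1) ≤ 1 / γ →
      ∃ j, f (tileAt P x i) = tileAt P y' j ∧ |vert P x i - vert P y' j| ≤ γ ∧
        |vert P x (i + 1) - vert P y' (j + 1)| ≤ γ ∧ dist (x.2 i) (y'.2 j) ≤ γ := by
    intro i hi1 hi2
    have hlt := (vert_lt_iff P x).2 (lt_add_one i)
    obtain ⟨⟨j, hj⟩, hd⟩ := hf (tileAt P x i) ⟨i, rfl⟩ ((vert P x i + vert P x (i + 1)) / 2)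
      (by rw [tileAt_leftEnd]; linarith) (by rw [tileAt_rightEnd]; linarith)
      (by rw [abs_le]; constructor <;> linarith)
    rw [← hj] at hd
    refine ⟨j, hj.symm, ?_, ?_, ?_⟩
    · simpa using ((abs_leftEnd_sub_le_tileDist P _ _).trans hd).trans hεγ.le
    · simpa using ((abs_rightEnd_sub_le_tileDist P _ _).trans hd).trans hεγ.le
    · simpa using ((dist_label_le_tileDist P _ _).trans hd).trans hεγ.le
  obtain ⟨k, -, hk1, hk2, hk3⟩ := key 0 h0 (by simpa using h1)
  refine ⟨k +ᵥ y', row_vadd P k y', fun n hn1 hn2 i hi => ?_⟩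
  -- Consecutive tiles have consecutive partners, because there is no room for a gap.
  have step : ∀ i ∈ Icc (-n : ℤ) n, |vert P x i - vert P y' (i + k)| ≤ γ ∧
      |vert P x (i + 1) - vert P y' (i + 1 + k)| ≤ γ ∧ dist (x.2 i) (y'.2 (i + k)) ≤ γ := by
    intro i
    have hb : ∀ i ∈ Icc (-n : ℤ) n, -(1 / γ) ≤ vert P x i ∧ vert P x (i + 1) ≤ 1 / γ :=
      fun i hi => ⟨hn1.trans ((vert_le_iff P x).2 hi.1),
        ((vert_le_iff P x).2 (by have := hi.2; omega)).trans hn2⟩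
    induction i with
    | zero => intro _; simpa [add_comm] using ⟨hk1, hk2, hk3⟩
    | succ i ih =>
      intro hi
      obtain ⟨-, ih, -⟩ := ih ⟨by omega, by have := hi.2; omega⟩
      obtain ⟨j, -, hj1, hj2, hj3⟩ := key (i + 1) (hb _ hi).1 (hb _ hi).2
      have : j = i + 1 + k := eq_of_abs_vert_sub_lt P y' (by
        rw [abs_le] at ih hj1; rw [abs_lt]; constructor <;> linarith)
      subst this
      refine ⟨hj1, ?_, hj3⟩
      convert hj2 using 4
      ring
    | pred i ih =>
      intro hi
      obtain ⟨ih, -, -⟩ := ih ⟨by have := hi.1; omega, by omega⟩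
      obtain ⟨j, -, hj1, hj2, hj3⟩ := key (-i - 1) (hb _ hi).1 (hb _ hi).2
      have hj2' := hj2
      rw [sub_add_cancel] at hj2'
      have : j + 1 = -i + k := eq_of_abs_vert_sub_lt P y' (by
        rw [abs_le] at ih hj2'; rw [abs_lt]; constructor <;> linarith)
      obtain rfl : j = -i - 1 + k := by omega
      refine ⟨hj1, ?_, hj3⟩
      convert hj2 using 4
      ring
  rw [vert_vadd]
  exact ⟨(step i hi).1, (step i hi).2.2⟩

/-- Tilings close to one described by `x` have descriptions close to `x`. -/
theorem eventually_exists_row_eq (x₀ : ℝ × (ℤ → L)) {N : Set (ℝ × (ℤ → L))} (hN : N ∈ 𝓝 x₀) :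
    ∀ᶠ z : ℝ × (ℝ × (ℤ → L)) in 𝓝[>] 0 ×ˢ 𝓝 x₀, ∀ T : Tiling P,
      tilingDist (row P z.2) T < z.1 → ∃ y ∈ N, row P y = T := by
  classical
  have hδ := P.minLen_pos
  -- The matching descriptions converge to `x₀` as the distance goes to `0`.
  let F : Filter ((ℝ × (ℝ × (ℤ → L))) × Tiling P) :=
    ((𝓝[>] 0 ×ˢ 𝓝 x₀) ×ˢ ⊤) ⊓ 𝓟 {z | tilingDist (row P z.1.2) z.2 < z.1.1}
  let good : (ℝ × (ℝ × (ℤ → L))) × Tiling P → (ℝ × (ℤ → L)) → Prop := fun z y =>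
    row P y = z.2 ∧ ∀ n : ℕ, -(1 / z.1.1) ≤ vert P z.1.2 (-n) →
      vert P z.1.2 (n + 1) ≤ 1 / z.1.1 → ∀ i ∈ Icc (-n : ℤ) n,
        |vert P z.1.2 i - vert P y i| ≤ z.1.1 ∧ dist (z.1.2.2 i) (y.2 i) ≤ z.1.1
  have hγ : Tendsto (fun z : (ℝ × (ℝ × (ℤ → L))) × Tiling P => z.1.1) F (𝓝[>] 0) :=
    (tendsto_fst.comp tendsto_fst).mono_left inf_le_left
  have hγ0 : Tendsto (fun z : (ℝ × (ℝ × (ℤ → L))) × Tiling P => z.1.1) F (𝓝 0) :=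
    hγ.mono_right nhdsWithin_le_nhds
  have hx : Tendsto (fun z : (ℝ × (ℝ × (ℤ → L))) × Tiling P => z.1.2) F (𝓝 x₀) :=
    (tendsto_snd.comp tendsto_fst).mono_left inf_le_left
  have hinv : Tendsto (fun z : (ℝ × (ℝ × (ℤ → L))) × Tiling P => 1 / z.1.1) F atTop := by
    simp only [one_div]
    exact tendsto_inv_nhdsGT_zero.comp hγ
  have hvx : ∀ i, Tendsto (fun z : (ℝ × (ℝ × (ℤ → L))) × Tiling P => vert P z.1.2 i) F
      (𝓝 (vert P x₀ i)) := fun i => ((continuous_vert P i).tendsto x₀).comp hx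
  have hball : ∀ n : ℕ, ∀ᶠ z in F, -(1 / z.1.1) ≤ vert P z.1.2 (-n) ∧
      vert P z.1.2 (n + 1) ≤ 1 / z.1.1 := by
    intro n
    filter_upwards [(hvx (-n)).eventually_const_lt (sub_one_lt _),
      (hvx (n + 1)).eventually_lt_const (lt_add_one _),
      hinv.eventually_ge_atTop (-(vert P x₀ (-n) - 1)),
      hinv.eventually_ge_atTop (vert P x₀ (n + 1) + 1)] with z h1 h2 h3 h4
    constructor <;> linarith
  have hgood : ∀ᶠ z in F, ∃ y, good z y := by
    filter_upwards [hball 0, hγ0.eventually_lt_const one_pos,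
      hγ0.eventually_lt_const (half_pos hδ), mem_inf_of_right (mem_principal_self _)]
      with z h1 h2 h3 h4
    exact exists_row_eq_of_tilingDist_lt P h2.le (by linarith) h4 (by simpa using h1.1)
      (by simpa using h1.2)
  let φ : (ℝ × (ℝ × (ℤ → L))) × Tiling P → ℝ × (ℤ → L) := fun z =>
    if h : ∃ y, good z y then h.choose else x₀
  have hφ : ∀ᶠ z in F, good z (φ z) := by
    filter_upwards [hgood] with z hz
    simp only [φ, dif_pos hz]
    exact hz.choose_spec
  have hcl : ∀ i : ℤ, ∀ᶠ z in F, |vert P z.1.2 i - vert P (φ z) i| ≤ z.1.1 ∧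
      dist (z.1.2.2 i) ((φ z).2 i) ≤ z.1.1 := by
    intro i
    filter_upwards [hφ, hball i.natAbs] with z h1 h2
    exact h1.2 i.natAbs h2.1 h2.2 i ⟨by omega, by omega⟩
  have hlab : Tendsto (fun z => (φ z).2) F (𝓝 x₀.2) := by
    rw [tendsto_pi_nhds]
    intro i
    have h1 : Tendsto (fun z : (ℝ × (ℝ × (ℤ → L))) × Tiling P => z.1.2.2 i) F (𝓝 (x₀.2 i)) :=
      (((continuous_apply i).comp continuous_snd).tendsto x₀).comp hx
    refine h1.congr_dist (squeeze_zero' (Eventually.of_forall fun _ => dist_nonneg) ?_ hγ0)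
    filter_upwards [hcl i] with z hz using hz.2
  have hvert : Tendsto (fun z => vert P (φ z) 0) F (𝓝 (vert P x₀ 0)) := by
    refine (hvx 0).congr_dist (squeeze_zero' (Eventually.of_forall fun _ => dist_nonneg) ?_ hγ0)
    filter_upwards [hcl 0] with z hz using hz.1
  have hpos : Tendsto (fun z => (φ z).1) F (𝓝 x₀.1) := by
    have h1 : Tendsto (fun z => arc P (φ z).2 x₀.1 0) F (𝓝 (arc P x₀.2 x₀.1 0)) :=
      ((continuous_arc_labels P x₀.1 0).tendsto x₀.2).comp hlab
    have h2 : Tendsto (fun z => |vert P (φ z) 0 - arc P (φ z).2 x₀.1 0| / P.minLen) F (𝓝 0) := by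
      have := ((hvert.sub h1).abs).div_const P.minLen
      simpa [vert] using this
    rw [tendsto_iff_dist_tendsto_zero]
    refine squeeze_zero (fun _ => dist_nonneg) (fun z => ?_) h2
    rw [le_div_iff₀ hδ, mul_comm, Real.dist_eq]
    have h3 := arc_add P (φ z).2 x₀.1 (φ z).1 0
    have h4 : vert P (φ z) 0 - arc P (φ z).2 x₀.1 0 = - arc P (φ z).2 x₀.1 (φ z).1 := by
      simp only [vert, Int.cast_zero]; linarith
    rw [h4, abs_neg]
    exact mul_abs_le_abs_arc P _ _ _
  have hlim : Tendsto φ F (𝓝 x₀) := by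
    have := hpos.prodMk_nhds hlab
    simpa using this
  have hfin : ∀ᶠ z in F, φ z ∈ N ∧ good z (φ z) := (hlim.eventually_mem hN).and hφ
  rw [eventually_inf_principal] at hfin
  have := mem_prod_top.1 hfin
  filter_upwards [this] with z hz T hT
  exact ⟨_, (hz T hT).1, (hz T hT).2.1⟩

end Distance

/-! ### The topology of the space of tilings -/

section Topology

variable {L : Type u} [MetricSpace L] [CompactSpace L] (P : Prototiles L)

theorem continuous_row : Continuous (row P) := by
  refine continuous_def.2 fun U hU => isOpen_iff_mem_nhds.2 fun x hx => ?_
  obtain ⟨ε, hε, h⟩ := hU (row P x) hx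
  have h1 : Tendsto (fun y => (x, y)) (𝓝 x) (𝓝 x ×ˢ 𝓝 x) :=
    tendsto_const_nhds.prodMk tendsto_id
  filter_upwards [h1.eventually (eventually_tilingDist_row_lt P x hε)] with y hy using h _ hy

/-- The topology of the tiling distance is the quotient topology of the space of descriptions. -/
theorem isQuotientMap_row : IsQuotientMap (row P) := by
  refine (isQuotientMap_iff _).2 ⟨isCoinducing_iff.2 fun U => ⟨fun h => ?_,
    fun h => h.preimage (continuous_row P)⟩, row_surjective P⟩
  intro T hT
  obtain ⟨x, rfl⟩ := row_surjective P T
  have h1 := (eventually_exists_row_eq P x (h.mem_nhds hT)).curry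
  obtain ⟨γ, hγ, hγ0⟩ := (h1.and self_mem_nhdsWithin).exists
  refine ⟨γ, hγ0, fun T' hT' => ?_⟩
  obtain ⟨y, hy, rfl⟩ := hγ.self_of_nhds T' hT'
  exact hy

theorem isAddQuotientCoveringMap_row : IsAddQuotientCoveringMap (row P) ℤ where
  toIsQuotientMap := isQuotientMap_row P
  continuous_const_vadd k :=
    (continuous_fst.sub continuous_const).prodMk ((continuous_renumber k).comp continuous_snd)
  apply_eq_iff_mem_orbit := row_eq_row_iff P
  disjoint x := by
    refine ⟨{y | |y.1 - x.1| < 1 / 2}, ?_, ?_⟩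
    · refine (isOpen_lt (continuous_fst.sub continuous_const).abs continuous_const).mem_nhds ?_
      simp
    · rintro k ⟨_, ⟨y, hy, rfl⟩, hy'⟩
      simp only [mem_ofPred_eq, vadd_def] at hy hy'
      have : |(k : ℝ)| < 1 := by
        rw [abs_lt] at hy hy' ⊢
        constructor <;> linarith
      exact Int.abs_lt_one_iff.1 (by exact_mod_cast this)

theorem isCoveringMap_row : IsCoveringMap (row P) := (isAddQuotientCoveringMap_row P).isCoveringMap

theorem isOpenQuotientMap_row : IsOpenQuotientMap (row P) :=
  (isAddQuotientCoveringMap_row P).isOpenQuotientMap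

theorem map_row_nhds (x : ℝ × (ℤ → L)) : map (row P) (𝓝 x) = 𝓝 (row P x) :=
  (isOpenQuotientMap_row P).isOpenMap.map_nhds_eq (continuous_row P).continuousAt

instance : T2Space (Tiling P) := by
  refine (t2Space_iff_of_isOpenQuotientMap (isOpenQuotientMap_row P)).2 ?_
  have h : {q : (ℝ × (ℤ → L)) × ℝ × (ℤ → L) | row P q.1 = row P q.2} =
      ⋃ k : ℤ, {q | q.1 = k +ᵥ q.2} := by
    ext q
    simp only [mem_ofPred_eq, mem_iUnion, row_eq_row_iff, eq_comm]
  rw [h]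
  refine LocallyFinite.isClosed_iUnion ?_ fun k => isClosed_eq continuous_fst
    (((isAddQuotientCoveringMap_row P).continuous_const_vadd k).comp continuous_snd)
  intro q
  refine ⟨{p | |(p.2.1 - p.1.1) - (q.2.1 - q.1.1)| < 1}, ?_, ?_⟩
  · refine (isOpen_lt ?_ continuous_const).mem_nhds (by simp)
    fun_prop
  · refine (finite_Icc (⌊(q.2.1 - q.1.1) - 1⌋) ⌈(q.2.1 - q.1.1) + 1⌉).subset ?_
    rintro k ⟨p, hp, hp'⟩
    simp only [mem_ofPred_eq, vadd_def] at hp hp'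
    rw [hp] at hp'
    simp only [abs_lt] at hp'
    constructor
    · have := Int.floor_le ((q.2.1 - q.1.1) - 1)
      exact_mod_cast this.trans (by linarith : q.2.1 - q.1.1 - 1 ≤ k)
    · have := Int.le_ceil ((q.2.1 - q.1.1) + 1)
      exact_mod_cast (by linarith : (k : ℝ) ≤ q.2.1 - q.1.1 + 1).trans this

/-- Every tiling has a description with the origin in the tile number `0`. -/
theorem exists_row_eq_of_mem_Icc (T : Tiling P) : ∃ x, x.1 ∈ Icc (0 : ℝ) 1 ∧ row P x = T := by
  obtain ⟨x, rfl⟩ := row_surjective P T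
  refine ⟨⌊x.1⌋ +ᵥ x, ⟨?_, ?_⟩, row_vadd P _ x⟩
  · simp [vadd_def]
  · have := Int.lt_floor_add_one x.1
    simp only [vadd_def]
    linarith

instance : CompactSpace (Tiling P) := by
  have h : IsCompact (row P '' (Icc (0 : ℝ) 1 ×ˢ univ)) :=
    (isCompact_Icc.prod isCompact_univ).image (continuous_row P)
  refine isCompact_univ_iff.1 (h.of_isClosed_subset isClosed_univ fun T _ => ?_)
  obtain ⟨x, hx, rfl⟩ := exists_row_eq_of_mem_Icc P T
  exact ⟨x, ⟨hx, trivial⟩, rfl⟩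

/-- The parameter of the point at the position `s` in the tiling described by `x`. -/
def paramAt (x : ℝ × (ℤ → L)) (s : ℝ) : ℝ := (arcIso P x.2 x.1).symm s

@[simp]
theorem arc_paramAt (x : ℝ × (ℤ → L)) (s : ℝ) : arc P x.2 x.1 (paramAt P x s) = s :=
  (arcIso P x.2 x.1).apply_symm_apply s

theorem row_shift_eq (x : ℝ × (ℤ → L)) (s : ℝ) :
    (row P x).shift s = row P (paramAt P x s, x.2) := by
  rw [← row_shift P x.1 (paramAt P x s) x.2, arc_paramAt]

theorem continuous_paramAt :
    Continuous fun z : (ℝ × (ℤ → L)) × ℝ => paramAt P z.1 z.2 := by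
  refine continuous_iff_continuousAt.2 fun z₀ => ?_
  set b := paramAt P z₀.1 z₀.2 with hb
  have hc : Continuous fun z : (ℝ × (ℤ → L)) × ℝ => |arc P z.1.2 z.1.1 b - z.2| / P.minLen :=
    ((((continuous_arc P b).comp continuous_fst).sub continuous_snd).abs).div_const _
  have hlim : Tendsto (fun z : (ℝ × (ℤ → L)) × ℝ => |arc P z.1.2 z.1.1 b - z.2| / P.minLen)
      (𝓝 z₀) (𝓝 0) := by
    have := hc.tendsto z₀
    simpa [hb] using this
  refine tendsto_iff_dist_tendsto_zero.2 (squeeze_zero (fun _ => dist_nonneg) (fun z => ?_) hlim)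
  rw [le_div_iff₀ P.minLen_pos, mul_comm, Real.dist_eq]
  have h1 := arc_add P z.1.2 z.1.1 b (paramAt P z.1 z.2)
  rw [arc_paramAt] at h1
  have h2 : arc P z.1.2 z.1.1 b - z.2 = -arc P z.1.2 b (paramAt P z.1 z.2) := by linarith
  rw [h2, abs_neg]
  exact mul_abs_le_abs_arc P _ _ _

theorem continuous_shift : Continuous fun z : Tiling P × ℝ => z.1.shift z.2 := by
  refine ((isOpenQuotientMap_row P).prodMap IsOpenQuotientMap.id).isQuotientMap.continuous_iff.2 ?_
  have : (fun z : Tiling P × ℝ => z.1.shift z.2) ∘ Prod.map (row P) id =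
      fun z : (ℝ × (ℤ → L)) × ℝ => row P (paramAt P z.1 z.2, z.1.2) :=
    funext fun z => row_shift_eq P z.1 z.2
  rw [this]
  exact (continuous_row P).comp
    ((continuous_paramAt P).prodMk (continuous_snd.comp continuous_fst))

variable {P}

/-- Two translates of a tile by nearly the same vector cannot both belong to a tiling. -/
theorem Tiling.eq_of_shift_mem (T : Tiling P) {t : Tile L} {a b : ℝ} (ha : t.shift a ∈ T.tiles)
    (hb : t.shift b ∈ T.tiles) (hab : |a - b| < P.minLen) : a = b := by
  rw [abs_lt] at hab
  have h1 := t.add_minLen_le P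
  rcases T.eq_or_rightEnd_le ha hb with h | h | h
  · have := congrArg Tile.pos h
    simpa using this
  · simp only [Tile.rightEnd_shift, Tile.leftEnd_shift] at h; linarith
  · simp only [Tile.rightEnd_shift, Tile.leftEnd_shift] at h; linarith

/-- Nonzero periods of a tiling are not shorter than the shortest tile. -/
theorem Tiling.shift_injective_of_lt (T : Tiling P) {a b : ℝ} (h : T.shift a = T.shift b)
    (hab : |a - b| < P.minLen) : a = b := by
  obtain ⟨t, ht, -⟩ := T.exists_mem 0
  refine (T.shift a).eq_of_shift_mem (t := t) ⟨t, ht, rfl⟩ ?_ hab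
  rw [h]
  exact ⟨t, ht, rfl⟩

theorem eventually_tilingDist_lt (T₀ : Tiling P) {ε : ℝ} (hε : 0 < ε) :
    ∀ᶠ z in 𝓝 T₀ ×ˢ 𝓝 T₀, tilingDist z.1 z.2 < ε := by
  obtain ⟨x, rfl⟩ := row_surjective P T₀
  rw [← map_row_nhds, prod_map_map_eq, eventually_map]
  exact eventually_tilingDist_row_lt P x hε

/-- The balls of the tiling distance shrink to their centres, locally uniformly in the centre. -/
theorem eventually_mem_of_tilingDist_lt (T₀ : Tiling P) {U : Set (Tiling P)} (hU : U ∈ 𝓝 T₀) :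
    ∀ᶠ z : ℝ × Tiling P in 𝓝[>] 0 ×ˢ 𝓝 T₀, ∀ T, tilingDist z.2 T < z.1 → T ∈ U := by
  obtain ⟨x, rfl⟩ := row_surjective P T₀
  rw [← map_row_nhds, ← map_id (f := 𝓝[>] (0 : ℝ)), prod_map_map_eq, eventually_map]
  filter_upwards [eventually_exists_row_eq P x ((continuous_row P).continuousAt hU)]
    with z hz T hT
  obtain ⟨y, hy, rfl⟩ := hz T hT
  exact hy

/-- Continuous maps between closed sets of tilings are uniformly continuous for the tiling
distances. -/
theorem exists_tilingDist_lt_of_continuous {L' : Type v} [MetricSpace L'] [CompactSpace L']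
    {P' : Prototiles L'} {Ω : Set (Tiling P)} (hΩ : IsClosed Ω) {f : Ω → Tiling P'}
    (hf : Continuous f) {ε : ℝ} (hε : 0 < ε) :
    ∃ γ > 0, ∀ T T' : Ω, tilingDist T.1 T'.1 < γ → tilingDist (f T) (f T') < ε := by
  have hcpt : CompactSpace Ω := isCompact_iff_compactSpace.1 hΩ.isCompact
  have key : ∀ T₀ ∈ (univ : Set Ω), ∀ᶠ z : ℝ × Ω in 𝓝 (0, T₀), 0 < z.1 → ∀ T' : Ω,
      tilingDist z.2.1 T'.1 < z.1 → tilingDist (f z.2) (f T') < ε := by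
    intro T₀ _
    have h1 : ∀ᶠ z in 𝓝 T₀ ×ˢ 𝓝 T₀, tilingDist (f z.1) (f z.2) < ε :=
      (hf.tendsto T₀).prodMap (hf.tendsto T₀) |>.eventually (eventually_tilingDist_lt (f T₀) hε)
    obtain ⟨V, hV, hV'⟩ := mem_prod_same_iff.1 h1
    obtain ⟨U, hU, hUV⟩ := mem_nhds_subtype _ _ _ |>.1 hV
    have h2 : ∀ᶠ z : ℝ × Ω in 𝓝[>] 0 ×ˢ 𝓝 T₀, ∀ T, tilingDist z.2.1 T < z.1 → T ∈ U :=
      ((tendsto_id (x := 𝓝[>] (0 : ℝ))).prodMap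
        (continuous_subtype_val.tendsto T₀)).eventually (eventually_mem_of_tilingDist_lt T₀.1 hU)
    have h3 : ∀ᶠ z : ℝ × Ω in 𝓝[>] 0 ×ˢ 𝓝 T₀, z.2 ∈ V := tendsto_snd.eventually hV
    have h4 : ∀ᶠ z : ℝ × Ω in 𝓝[>] 0 ×ˢ 𝓝 T₀, ∀ T' : Ω,
        tilingDist z.2.1 T'.1 < z.1 → tilingDist (f z.2) (f T') < ε := by
      filter_upwards [h2, h3] with z hz hz' T' hT'
      exact hV' (show (z.2, T') ∈ V ×ˢ V from ⟨hz', hUV (hz T' hT')⟩)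
    rw [← nhdsWithin_univ T₀, ← nhdsWithin_prod_eq, eventually_nhdsWithin_iff] at h4
    filter_upwards [h4] with z hz hz0 using hz ⟨hz0, trivial⟩
  have := isCompact_univ.eventually_forall_of_forall_eventually (P := fun (γ : ℝ) (T : Ω) =>
    0 < γ → ∀ T' : Ω, tilingDist T.1 T'.1 < γ → tilingDist (f T) (f T') < ε) key
  obtain ⟨γ, hγ, h⟩ := Metric.eventually_nhds_iff.1 this
  refine ⟨γ / 2, half_pos hγ, fun T T' hT => h ?_ T trivial (half_pos hγ) T' hT⟩
  rw [Real.dist_eq, sub_zero, abs_of_pos (half_pos hγ)]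
  exact half_lt_self hγ

end Topology

/-! ### Total disconnectedness and intervals -/

section TotallyDisconnected

/-- Total disconnectedness of compact Hausdorff spaces is a local property. -/
theorem totallyDisconnectedSpace_of_locally {X : Type*} [TopologicalSpace X] [T2Space X]
    [CompactSpace X] (h : ∀ x : X, ∃ N ∈ 𝓝 x, IsTotallyDisconnected N) :
    TotallyDisconnectedSpace X := by
  refine ⟨fun C _ hC x hx y hy => ?_⟩
  obtain ⟨N, hN, htd⟩ := h x
  obtain ⟨F, hF, hFN, hFc⟩ := local_compact_nhds hN
  have : CompactSpace F := isCompact_iff_compactSpace.1 hFc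
  have : TotallyDisconnectedSpace F :=
    totallyDisconnectedSpace_subtype_iff.2 fun t ht => htd t (ht.trans hFN)
  obtain ⟨D, hD, hxD, hDU⟩ := compact_exists_isClopen_in_isOpen (X := F)
    (x := ⟨x, mem_of_mem_nhds hF⟩)
    (isOpen_interior.preimage continuous_subtype_val) (mem_interior_iff_mem_nhds.2 hF)
  -- A clopen subset of `F` which stays in the interior of `F` is clopen in `X`.
  have hclopen : IsClopen (Subtype.val '' D) := by
    refine ⟨hFc.isClosed.isClosedEmbedding_subtypeVal.isClosedMap _ hD.1, ?_⟩
    obtain ⟨O, hO, rfl⟩ := isOpen_induced_iff.1 hD.2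
    have : Subtype.val '' (Subtype.val ⁻¹' O : Set F) = O ∩ interior F := by
      ext z
      constructor
      · rintro ⟨w, hw, rfl⟩
        exact ⟨hw, hDU hw⟩
      · rintro ⟨h1, h2⟩
        exact ⟨⟨z, interior_subset h2⟩, h1, rfl⟩
    rw [this]
    exact hO.inter isOpen_interior
  have hsub : C ⊆ Subtype.val '' D := hC.subset_isClopen hclopen ⟨x, hx, ⟨_, hxD, rfl⟩⟩
  refine htd C (hsub.trans ?_) hC hx hy
  rintro _ ⟨w, -, rfl⟩
  exact hFN w.2

theorem isOpen_image_Ioo {g : ℝ → ℝ} {a b : ℝ} (hab : a ≤ b) (hc : ContinuousOn g (Icc a b))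
    (hi : InjOn g (Icc a b)) : IsOpen (g '' Ioo a b) := by
  rcases hc.strictMonoOn_of_injOn_Icc' hab hi with hm | hm
  · have : g '' Ioo a b = Ioo (g a) (g b) := by
      refine Subset.antisymm ?_ (intermediate_value_Ioo hab hc)
      rintro _ ⟨x, hx, rfl⟩
      exact ⟨hm (left_mem_Icc.2 hab) (Ioo_subset_Icc_self hx) hx.1,
        hm (Ioo_subset_Icc_self hx) (right_mem_Icc.2 hab) hx.2⟩
    rw [this]
    exact isOpen_Ioo
  · have : g '' Ioo a b = Ioo (g b) (g a) := by
      refine Subset.antisymm ?_ (intermediate_value_Ioo' hab hc)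
      rintro _ ⟨x, hx, rfl⟩
      exact ⟨hm (Ioo_subset_Icc_self hx) (right_mem_Icc.2 hab) hx.2,
        hm (left_mem_Icc.2 hab) (Ioo_subset_Icc_self hx) hx.1⟩
    rw [this]
    exact isOpen_Ioo

end TotallyDisconnected

/-! ### Label sequences and path lifting -/

section Sequences

variable {L : Type u} [MetricSpace L] [CompactSpace L] {P : Prototiles L} {Ω : Set (Tiling P)}

/-- The label sequences of the tilings in `Ω`. -/
def sequences (Ω : Set (Tiling P)) : Set (ℤ → L) := {c | row P (0, c) ∈ Ω}

theorem mem_sequences_iff (hΩ : IsTilingSpace Ω) (r : ℝ) (c : ℤ → L) :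
    c ∈ sequences Ω ↔ row P (r, c) ∈ Ω := by
  constructor
  · intro h
    rw [← row_shift P 0 r c]
    exact hΩ.shift_mem _ h _
  · intro h
    change row P (0, c) ∈ Ω
    rw [← row_shift P r 0 c]
    exact hΩ.shift_mem _ h _

theorem renumber_mem_sequences (hΩ : IsTilingSpace Ω) (k : ℤ) {c : ℤ → L}
    (hc : c ∈ sequences Ω) : renumber k c ∈ sequences Ω := by
  rw [mem_sequences_iff hΩ (0 - k)]
  change row P (k +ᵥ ((0 : ℝ), c)) ∈ Ω
  rw [row_vadd]
  exact hc

theorem isClosed_sequences (hΩ : IsTilingSpace Ω) : IsClosed (sequences Ω) :=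
  hΩ.isClosed.preimage ((continuous_row P).comp (Continuous.prodMk_right 0))

theorem isTotallyDisconnected_sequences
    (h : IsTotallyDisconnected (transversal Ω)) (hΩ : IsTilingSpace Ω) :
    IsTotallyDisconnected (sequences Ω) := by
  intro C hC hpre
  -- Move the control point of the tile number `0` to the origin.
  let q : (ℤ → L) → Tiling P := fun c => (row P (0, c)).shift (-P.left (c 0))
  have hq : Continuous q := (continuous_shift P).comp
    (((continuous_row P).comp (Continuous.prodMk_right 0)).prodMk
      (P.continuous_left.comp (continuous_apply 0)).neg)
  have hqC : q '' C ⊆ transversal Ω := by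
    rintro _ ⟨c, hc, rfl⟩
    refine ⟨hΩ.shift_mem _ (hC hc) _, _, ⟨tileAt P (0, c) 0, ⟨0, rfl⟩, rfl⟩, ?_⟩
    simp [tileAt, vert, Tile.shift]
  have hsub := h _ hqC (hpre.image q hq.continuousOn)
  rintro c hc d hd
  have hcount : C ⊆ range fun k : ℤ => renumber k c := by
    intro c' hc'
    have h1 : q c' = q c := hsub ⟨c', hc', rfl⟩ ⟨c, hc, rfl⟩
    have h2 := congrArg (Tiling.shift (P.left (c' 0))) h1
    simp only [q, Tiling.shift_shift, neg_add_cancel, Tiling.shift_zero] at h2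
    rw [row_shift_eq] at h2
    obtain ⟨k, hk⟩ := (row_eq_row_iff P).1 h2
    exact ⟨k, congrArg Prod.snd hk⟩
  let := TopologicalSpace.metrizableSpaceMetric (ℤ → L)
  exact ((countable_range _).mono hcount).isTotallyDisconnected C Subset.rfl hpre hc hd

/-- When the label sequences form a totally disconnected set, a path in the tiling space moves along
a single orbit of the translation action, and lifts to a path in `ℝ`. -/
theorem exists_lift (hΩ : IsTilingSpace Ω) (htd : IsTotallyDisconnected (sequences Ω))
    {α : ℝ → Tiling P} (hα : Continuous α) (hmem : ∀ x, α x ∈ Ω) :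
    ∃ φ : ℝ → ℝ, Continuous φ ∧ φ 0 = 0 ∧ ∀ x, α x = (α 0).shift (φ x) := by
  obtain ⟨x₀, hx₀⟩ := row_surjective P (α 0)
  obtain ⟨F, ⟨hF0, hF⟩, -⟩ :=
    (isCoveringMap_row P).existsUnique_continuousMap_lifts ⟨α, hα⟩ 0 x₀ hx₀
  have hrow : ∀ x, row P (F x) = α x := fun x => congrFun hF x
  have hconst : ∀ x, (F x).2 = x₀.2 := by
    have hsub : range (fun x => (F x).2) ⊆ sequences Ω := by
      rintro _ ⟨x, rfl⟩
      rw [mem_sequences_iff hΩ (F x).1, Prod.mk.eta, hrow]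
      exact hmem x
    have hpre : IsPreconnected (range fun x => (F x).2) :=
      isPreconnected_range (continuous_snd.comp F.continuous)
    intro x
    rw [← hF0]
    exact htd _ hsub hpre ⟨x, rfl⟩ ⟨0, rfl⟩
  refine ⟨fun x => arc P x₀.2 x₀.1 (F x).1,
    (continuous_arc_right P _ _).comp (continuous_fst.comp F.continuous), by simp [hF0],
    fun x => ?_⟩
  rw [← hx₀, row_shift P x₀.1, ← hconst x, Prod.mk.eta, hrow]

/-- In a tiling space with finite local complexity only finitely many labels occur. -/
theorem HasFLC.finite_labels (h : HasFLC Ω) :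
    ∃ A : Set L, A.Finite ∧ ∀ T ∈ Ω, ∀ t ∈ T.tiles, t.label ∈ A := by
  obtain ⟨F, hF, h⟩ := h
  refine ⟨⋃ q ∈ {q ∈ F | q.Finite}, Tile.label '' q, ?_, fun T hT t ht => ?_⟩
  · exact (hF.subset (sep_subset _ _)).biUnion fun q hq => hq.2.image _
  · obtain ⟨x, rfl⟩ := row_surjective P T
    obtain ⟨i, rfl⟩ := ht
    have hp : tileAt P x '' Icc i (i + 1) ∈ twoTilePatches Ω := by
      refine ⟨isPatch_tileAt_image P x (by omega), ?_, row P x, hT, image_subset_range _ _⟩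
      rw [ncard_image_of_injective _ (tileAt_injective P x), ← Finset.coe_Icc, ncard_coe_finset,
        Int.card_Icc]
      omega
    obtain ⟨q, hq, y, hpq⟩ := h _ hp
    have hmem : tileAt P x i ∈ tileAt P x '' Icc i (i + 1) := ⟨i, ⟨le_rfl, by omega⟩, rfl⟩
    have hinj : Function.Injective (Tile.shift y : Tile L → Tile L) := fun s t hst => by
      have := congrArg (Tile.shift (-y)) hst
      simpa [Tile.shift_shift] using this
    have hfin : q.Finite := by
      refine Finite.of_finite_image ?_ hinj.injOn (f := Tile.shift y)
      rw [← hpq]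
      exact (finite_Icc _ _).image _
    rw [hpq] at hmem
    obtain ⟨s, hs, hst⟩ := hmem
    simp only [mem_iUnion, exists_prop]
    exact ⟨q, ⟨hq, hfin⟩, s, hs, by rw [← hst]; rfl⟩

theorem HasFLC.isTotallyDisconnected_sequences (h : HasFLC Ω) :
    IsTotallyDisconnected (sequences Ω) := by
  obtain ⟨A, hA, h⟩ := h.finite_labels
  intro C hC hpre c hc d hd
  ext i
  refine hA.countable.isTotallyDisconnected ((fun c => c i) '' C) ?_
    (hpre.image _ (continuous_apply i).continuousOn) ⟨c, hc, rfl⟩ ⟨d, hd, rfl⟩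
  rintro _ ⟨c, hc, rfl⟩
  exact h _ (hC hc) (tileAt P (0, c) i) ⟨i, rfl⟩

end Sequences

/-! ### Total disconnectedness of the transversal -/

section Transversal

variable {L : Type u} [MetricSpace L] [CompactSpace L] {P : Prototiles L} {Ω : Set (Tiling P)}

theorem isClosed_setOf_control_point (P : Prototiles L) :
    IsClosed {T : Tiling P | ∃ t ∈ T.tiles, t.pos = 0} := by
  have h : {T : Tiling P | ∃ t ∈ T.tiles, t.pos = 0} =
      row P '' ((Icc (0 : ℝ) 1 ×ˢ univ) ∩ {x | vert P x 0 = P.left (x.2 0)}) := by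
    ext T
    constructor
    · rintro ⟨t, ht, h0⟩
      obtain ⟨y, rfl⟩ := row_surjective P T
      obtain ⟨k, rfl⟩ := ht
      have h1 : vert P (k +ᵥ y) 0 = P.left ((k +ᵥ y).2 0) := by
        rw [vert_vadd]
        simp only [tileAt, sub_eq_zero] at h0
        simpa [vadd_def] using h0
      refine ⟨k +ᵥ y, ⟨⟨?_, trivial⟩, h1⟩, row_vadd P k y⟩
      have hl := P.left_nonpos ((k +ᵥ y).2 0)
      have hr := P.right_nonneg ((k +ᵥ y).2 0)
      have h2 : vert P (k +ᵥ y) 1 = P.right ((k +ᵥ y).2 0) := by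
        have := vert_add_one P (k +ᵥ y) 0
        rw [zero_add] at this
        rw [this, h1, Prototiles.len]
        ring
      have hm := arc_right_strictMono P (k +ᵥ y).2 (k +ᵥ y).1
      constructor
      · by_contra! hlt
        have h3 : arc P (k +ᵥ y).2 (k +ᵥ y).1 (k +ᵥ y).1 < arc P (k +ᵥ y).2 (k +ᵥ y).1 0 := hm hlt
        simp only [vert, Int.cast_zero] at h1
        rw [arc_self, h1] at h3
        linarith
      · by_contra! hlt
        have h3 : arc P (k +ᵥ y).2 (k +ᵥ y).1 1 < arc P (k +ᵥ y).2 (k +ᵥ y).1 (k +ᵥ y).1 := hm hlt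
        simp only [vert, Int.cast_one] at h2
        rw [arc_self, h2] at h3
        linarith
    · rintro ⟨x, ⟨-, hx⟩, rfl⟩
      exact ⟨tileAt P x 0, ⟨0, rfl⟩, sub_eq_zero.2 hx⟩
  rw [h]
  refine (((isCompact_Icc.prod isCompact_univ).inter_right ?_).image (continuous_row P)).isClosed
  exact isClosed_eq (continuous_vert P 0)
    (P.continuous_left.comp ((continuous_apply 0).comp continuous_snd))

theorem Tiling.countable_tiles (T : Tiling P) : T.tiles.Countable := by
  obtain ⟨x, rfl⟩ := row_surjective P T
  exact countable_range _

/-- Translation within a tiling space. -/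
def IsTilingSpace.shift (hΩ : IsTilingSpace Ω) (T : Ω) (x : ℝ) : Ω :=
  ⟨T.1.shift x, hΩ.shift_mem _ T.2 x⟩

theorem IsTilingSpace.continuous_shift (hΩ : IsTilingSpace Ω) :
    Continuous fun z : Ω × ℝ => hΩ.shift z.1 z.2 :=
  Continuous.subtype_mk ((LineTiling.continuous_shift P).comp
    ((continuous_subtype_val.comp continuous_fst).prodMk continuous_snd)) _

@[simp]
theorem IsTilingSpace.shift_zero (hΩ : IsTilingSpace Ω) (T : Ω) : hΩ.shift T 0 = T :=
  Subtype.ext (Tiling.shift_zero _)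

theorem IsTilingSpace.shift_injective_of_lt (hΩ : IsTilingSpace Ω) {T : Ω} {a b : ℝ}
    (h : hΩ.shift T a = hΩ.shift T b) (hab : |a - b| < P.minLen) : a = b :=
  T.1.shift_injective_of_lt (congrArg Subtype.val h) hab

/-- Nearby points of a tiling space on the same short piece of an orbit are much closer to each
other along that piece than its length. -/
theorem IsTilingSpace.exists_nhds_shift_ne (hΩ : IsTilingSpace Ω) (T₀ : Ω) {η : ℝ} (hη : 0 < η)
    (hη' : η < P.minLen) : ∃ N ∈ 𝓝 T₀, ∀ T ∈ N, ∀ x, |x| ≤ η → hΩ.shift T x ∈ N → |x| < η / 2 := by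
  have hK : IsCompact {x : ℝ | η / 2 ≤ |x| ∧ |x| ≤ η} := by
    refine (isCompact_Icc (a := -η) (b := η)).of_isClosed_subset ?_ fun x hx => abs_le.1 hx.2
    exact (isClosed_le continuous_const continuous_abs).inter
      (isClosed_le continuous_abs continuous_const)
  have key : ∀ x ∈ {x : ℝ | η / 2 ≤ |x| ∧ |x| ≤ η}, ∀ᶠ z : (Ω × Ω) × ℝ in 𝓝 ((T₀, T₀), x),
      hΩ.shift z.1.1 z.2 ≠ z.1.2 := by
    intro x hx
    refine (isOpen_ne_fun (hΩ.continuous_shift.comp ((continuous_fst.comp continuous_fst).prodMk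
      continuous_snd)) (continuous_snd.comp continuous_fst)).mem_nhds ?_
    intro h
    have h0 : x = 0 := hΩ.shift_injective_of_lt (T := T₀) (by simpa using h)
      (by rw [sub_zero]; exact hx.2.trans_lt hη')
    have := hx.1
    rw [h0, abs_zero] at this
    linarith
  have := hK.eventually_forall_of_forall_eventually
    (P := fun (z : Ω × Ω) (x : ℝ) => hΩ.shift z.1 x ≠ z.2) key
  rw [nhds_prod_eq] at this
  obtain ⟨N, hN, h⟩ := mem_prod_same_iff.1 this
  refine ⟨N, hN, fun T hT x hx hTx => ?_⟩
  by_contra! hlt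
  exact h (show (T, hΩ.shift T x) ∈ N ×ˢ N from ⟨hT, hTx⟩) x ⟨hlt, hx⟩ rfl

/-- A tiling space which is homeomorphic to one with totally disconnected label sequences has a
totally disconnected transversal.  Let `C` be a small connected subset of the space.  Its thickening
by short translations is still mapped to a set on which the label sequence is constant, hence
injects continuously into `ℝ`.  The short orbit piece through a point of `C` is mapped onto an open
interval, so that it contains a relatively clopen part of `C`, which is to say all of `C`. -/
theorem isTotallyDisconnected_transversal_of_homeomorph {L' : Type v} [MetricSpace L']
    [CompactSpace L'] {P' : Prototiles L'} {Ω' : Set (Tiling P')} (hΩ : IsTilingSpace Ω)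
    (hΩ' : IsTilingSpace Ω') (htd : IsTotallyDisconnected (sequences Ω')) (f : Ω ≃ₜ Ω') :
    IsTotallyDisconnected (transversal Ω) := by
  let Ξ : Set Ω := {T | ∃ t ∈ T.1.tiles, t.pos = 0}
  have hcpt : CompactSpace Ω := isCompact_iff_compactSpace.1 hΩ.isClosed.isCompact
  have hΞ : IsClosed Ξ := (isClosed_setOf_control_point P).preimage continuous_subtype_val
  have himage : transversal Ω = Subtype.val '' Ξ := by
    ext T
    exact ⟨fun h => ⟨⟨T, h.1⟩, h.2, rfl⟩, by rintro ⟨T, hT, rfl⟩; exact ⟨T.2, hT⟩⟩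
  rw [himage, IsEmbedding.subtypeVal.isTotallyDisconnected_image,
    ← totallyDisconnectedSpace_subtype_iff]
  have : CompactSpace Ξ := isCompact_iff_compactSpace.1 hΞ.isCompact
  refine totallyDisconnectedSpace_of_locally fun T₀ => ?_
  -- A local description of the tilings near the image of `T₀`.
  obtain ⟨x₀, hx₀⟩ := row_surjective P' (f T₀).1
  obtain ⟨e, hxe, he⟩ := (isCoveringMap_row P').isLocalHomeomorph x₀
  set V : Set Ω := {T | (f T).1 ∈ e.target} with hV
  have hVo : IsOpen V :=
    e.open_target.preimage (continuous_subtype_val.comp f.continuous)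
  have hT₀V : T₀.1 ∈ V := by
    change (f T₀).1 ∈ e.target
    rw [← hx₀, he]
    exact e.map_source hxe
  have hrow : ∀ T ∈ V, row P' (e.symm (f T).1) = (f T).1 := fun T hT => by
    rw [he]; exact e.right_inv hT
  have hecont : ContinuousOn (fun T : Ω => e.symm (f T).1) V :=
    e.continuousOn_symm.comp (continuous_subtype_val.comp f.continuous).continuousOn fun _ h => h
  let g : Ω → ℝ := fun T => (e.symm (f T).1).1
  have hg : ContinuousOn g V := continuous_fst.comp_continuousOn hecont
  obtain ⟨η, hη, hηδ, N₁, hN₁, hN₁V⟩ : ∃ η > 0, η < P.minLen / 2 ∧ ∃ N₁ ∈ 𝓝 T₀.1, ∀ T ∈ N₁,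
      ∀ x ∈ Icc (-η) η, hΩ.shift T x ∈ V := by
    have h1 : ∀ᶠ z : Ω × ℝ in 𝓝 (T₀.1, 0), hΩ.shift z.1 z.2 ∈ V :=
      hΩ.continuous_shift.continuousAt.eventually_mem (hVo.mem_nhds (by simpa using hT₀V))
    rw [nhds_prod_eq] at h1
    obtain ⟨N₁, hN₁, B, hB, h1⟩ := mem_prod_iff.1 h1
    obtain ⟨ρ, hρ, hρB⟩ := Metric.mem_nhds_iff.1 hB
    have hδ := P.minLen_pos
    refine ⟨min ρ (P.minLen / 2) / 2, by positivity, ?_, N₁, hN₁, fun T hT x hx => ?_⟩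
    · linarith [min_le_right ρ (P.minLen / 2)]
    · refine h1 (show (T, x) ∈ N₁ ×ˢ B from ⟨hT, hρB ?_⟩)
      rw [mem_ball_zero_iff, Real.norm_eq_abs]
      have : 0 < min ρ (P.minLen / 2) := by positivity
      exact (abs_le.2 hx).trans_lt (by linarith [min_le_left ρ (P.minLen / 2)])
  have hδ := P.minLen_pos
  obtain ⟨N₂, hN₂, hne⟩ := hΩ.exists_nhds_shift_ne T₀.1 hη (by linarith)
  refine ⟨Subtype.val ⁻¹' (N₁ ∩ N₂), continuous_subtype_val.continuousAt (inter_mem hN₁ hN₂),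
    fun D hD hDpre => ?_⟩
  set C : Set Ω := Subtype.val '' D with hCdef
  have hC : IsPreconnected C := hDpre.image _ continuous_subtype_val.continuousOn
  have hCN : C ⊆ N₁ ∩ N₂ := by rintro _ ⟨w, hw, rfl⟩; exact hD hw
  have hCΞ : C ⊆ Ξ := by rintro _ ⟨w, hw, rfl⟩; exact w.2
  suffices hsub : C.Subsingleton from fun a ha b hb =>
    Subtype.ext (hsub ⟨a, ha, rfl⟩ ⟨b, hb, rfl⟩)
  rintro T₁ hT₁ T₂ hT₂
  set C' : Set Ω := (fun z : Ω × ℝ => hΩ.shift z.1 z.2) '' (C ×ˢ Icc (-η) η) with hC'def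
  have hC' : IsPreconnected C' := (hC.prod isPreconnected_Icc).image _
    hΩ.continuous_shift.continuousOn
  have hC'V : C' ⊆ V := by
    rintro _ ⟨⟨T, x⟩, ⟨hT, hx⟩, rfl⟩
    exact hN₁V T (hCN hT).1 x hx
  have hCC' : C ⊆ C' := fun T hT =>
    ⟨(T, 0), ⟨hT, by constructor <;> linarith⟩, hΩ.shift_zero T⟩
  have hginj : InjOn g C' := by
    have hlab : ((fun T : Ω => (e.symm (f T).1).2) '' C').Subsingleton := by
      refine htd _ ?_ (hC'.image _ ((continuous_snd.comp_continuousOn hecont).mono hC'V))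
      rintro _ ⟨T, hT, rfl⟩
      rw [mem_sequences_iff hΩ' (e.symm (f T).1).1, Prod.mk.eta, hrow T (hC'V hT)]
      exact (f T).2
    intro T hT T' hT' h
    have h2 : e.symm (f T).1 = e.symm (f T').1 :=
      Prod.ext h (hlab ⟨T, hT, rfl⟩ ⟨T', hT', rfl⟩)
    apply f.injective
    apply Subtype.ext
    rw [← hrow T (hC'V hT), h2, hrow T' (hC'V hT')]
  have hpiece : ∀ x ∈ Icc (-η) η, hΩ.shift T₁ x ∈ C' := fun x hx => ⟨(T₁, x), ⟨hT₁, hx⟩, rfl⟩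
  have hpc : Continuous (hΩ.shift T₁) := hΩ.continuous_shift.comp (Continuous.prodMk_right T₁)
  have hopen : IsOpen ((fun x => g (hΩ.shift T₁ x)) '' Ioo (-η) η) := by
    refine isOpen_image_Ioo (by linarith)
      (hg.comp hpc.continuousOn fun x hx => hC'V (hpiece x hx)) fun x hx y hy hxy => ?_
    refine hΩ.shift_injective_of_lt (hginj (hpiece x hx) (hpiece y hy) hxy) ?_
    rw [abs_lt]
    constructor <;> linarith [hx.1, hx.2, hy.1, hy.2]
  have hsplit := isPreconnected_iff_subset_of_disjoint.1 hC
    (V ∩ g ⁻¹' ((fun x => g (hΩ.shift T₁ x)) '' Ioo (-η) η))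
    (hΩ.shift T₁ '' Icc (-(η / 2)) (η / 2))ᶜ (hg.isOpen_inter_preimage hVo hopen)
    (isCompact_Icc.image hpc).isClosed.isOpen_compl
    (by
      intro T hT
      by_cases hTm : T ∈ hΩ.shift T₁ '' Icc (-(η / 2)) (η / 2)
      · obtain ⟨x, hx, rfl⟩ := hTm
        exact Or.inl ⟨hC'V (hCC' hT), x, ⟨by linarith [hx.1], by linarith [hx.2]⟩, rfl⟩
      · exact Or.inr hTm)
    (by
      refine eq_empty_of_forall_notMem ?_
      rintro T ⟨hT, ⟨-, x, hx, hgx⟩, hTm⟩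
      have hTx := hginj (hpiece x (Ioo_subset_Icc_self hx)) (hCC' hT) hgx
      have hxη := hne T₁ (hCN hT₁).2 x (abs_le.2 (Ioo_subset_Icc_self hx))
        (by rw [hTx]; exact (hCN hT).2)
      exact hTm ⟨x, abs_le.1 hxη.le, hTx⟩)
  have hCu : C ⊆ hΩ.shift T₁ '' {x | ∃ t ∈ T₁.1.tiles, t.pos = x} := by
    rcases hsplit with h | h
    · intro T hT
      obtain ⟨-, x, hx, hgx⟩ := h hT
      have hTx := hginj (hpiece x (Ioo_subset_Icc_self hx)) (hCC' hT) hgx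
      refine ⟨x, ?_, hTx⟩
      obtain ⟨t, ht, ht0⟩ := hCΞ hT
      rw [← hTx] at ht
      obtain ⟨s, hs, rfl⟩ := ht
      exact ⟨s, hs, by simpa [sub_eq_zero] using ht0⟩
    · exact (h hT₁ ⟨0, by constructor <;> linarith, hΩ.shift_zero T₁⟩).elim
  have hcount : (g '' C).Countable := by
    refine (Countable.mono hCu (Countable.image ?_ _)).image g
    refine (T₁.1.countable_tiles.image Tile.pos).mono ?_
    rintro x ⟨t, ht, rfl⟩
    exact ⟨t, ht, rfl⟩
  exact hginj (hCC' hT₁) (hCC' hT₂) (hcount.isTotallyDisconnected _ Subset.rfl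
    (hC.image _ (hg.mono (hCC'.trans hC'V))) ⟨T₁, hT₁, rfl⟩ ⟨T₂, hT₂, rfl⟩)

end Transversal

/-! ### Strong expansivity from finite local complexity -/

section Expansive

variable {L : Type u} [MetricSpace L] [CompactSpace L] {P : Prototiles L} {Ω : Set (Tiling P)}

/-- A gap between two tiles which is shorter than every tile is empty. -/
theorem Tiling.rightEnd_eq_of_abs_lt (T : Tiling P) {s t : Tile L} (hs : s ∈ T.tiles)
    (ht : t ∈ T.tiles) (h : |s.rightEnd P - t.leftEnd P| < P.minLen) :
    s.rightEnd P = t.leftEnd P := by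
  obtain ⟨w, hw, hws⟩ := T.exists_next hs
  rw [abs_lt] at h
  have h1 := w.add_minLen_le P
  have h2 := t.add_minLen_le P
  rcases T.eq_or_rightEnd_le hw ht with rfl | h3 | h3
  · exact hws.symm
  · linarith
  · linarith

theorem Tiling.eq_of_subset {S T : Tiling P} (h : S.tiles ⊆ T.tiles) : S = T := by
  refine Tiling.ext (h.antisymm fun t ht => ?_)
  obtain ⟨s, hs, h1, h2⟩ := S.exists_mem ((t.leftEnd P + t.rightEnd P) / 2)
  have := t.leftEnd_lt_rightEnd P
  rcases T.eq_or_rightEnd_le ht (h hs) with h | h | h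
  · rwa [h]
  · linarith
  · linarith

/-- Near any given point, every point lies in a common tile with it. -/
theorem Tiling.eventually_exists_common (T : Tiling P) (y : ℝ) : ∀ᶠ z in 𝓝 y, ∃ t ∈ T.tiles,
    (t.leftEnd P ≤ y ∧ y ≤ t.rightEnd P) ∧ t.leftEnd P ≤ z ∧ z ≤ t.rightEnd P := by
  obtain ⟨x, rfl⟩ := row_surjective P T
  obtain ⟨i, h1, h2⟩ := exists_vert_le_lt P x y
  rcases h1.lt_or_eq with h1 | rfl
  · filter_upwards [Ioo_mem_nhds h1 h2] with z hz
    exact ⟨tileAt P x i, ⟨i, rfl⟩, by simp [h1.le, h2.le], by simp [hz.1.le, hz.2.le]⟩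
  · have h3 := (vert_lt_iff P x).2 (sub_one_lt i)
    filter_upwards [Ioo_mem_nhds h3 h2] with z hz
    rcases le_total (vert P x i) z with h | h
    · exact ⟨tileAt P x i, ⟨i, rfl⟩, by simp [h2.le], by simp [h, hz.2.le]⟩
    · exact ⟨tileAt P x (i - 1), ⟨i - 1, rfl⟩, by simp [h3.le], by simp [h, hz.1.le]⟩

/-- When only finitely many labels occur, close tilings differ near the origin by a single small
translation. -/
theorem exists_tilingDist_lt_imp_exists_shift_mem {A : Set L} (hA : A.Finite) {η : ℝ} (hη : 0 < η)
    (hη' : 2 * η < P.minLen) : ∃ ε > 0, ∀ S T : Tiling P, (∀ t ∈ S.tiles, t.label ∈ A) →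
      (∀ t ∈ T.tiles, t.label ∈ A) → tilingDist S T < ε → ∃ u, |u| < η ∧ ∀ t ∈ S.tiles,
        t.leftEnd P ≤ 0 → 0 ≤ t.rightEnd P → t.shift u ∈ T.tiles := by
  obtain ⟨σ, hσ, hsep⟩ : ∃ σ > 0, ∀ a ∈ A, ∀ b ∈ A, dist a b < σ → a = b := by
    rcases A.subsingleton_or_nontrivial with h | h
    · exact ⟨1, one_pos, fun a ha b hb _ => h ha hb⟩
    · obtain ⟨a, ha, b, hb, hab⟩ := h
      have hfin : (A.offDiag).Finite := hA.offDiag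
      obtain ⟨p, hp, hmin⟩ := hfin.exists_minimalFor (fun p : L × L => dist p.1 p.2) _
        ⟨(a, b), ha, hb, hab⟩
      refine ⟨dist p.1 p.2, dist_pos.2 hp.2.2, fun a ha b hb h => ?_⟩
      by_contra hne
      have := hmin (j := (a, b)) ⟨ha, hb, hne⟩ h.le
      exact absurd h (not_lt.2 this)
  refine ⟨min (min σ η) 1, by positivity, fun S T hS hT hST => ?_⟩
  obtain ⟨ε, hε0, hε, hagree⟩ := exists_agreeWithin_of_tilingDist_lt (min_le_right _ _) hST
  have hεσ : ε < σ := hε.trans_le ((min_le_left _ _).trans (min_le_left _ _))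
  have hεη : ε < η := hε.trans_le ((min_le_left _ _).trans (min_le_right _ _))
  have hε1 : ε < 1 := hε.trans_le (min_le_right _ _)
  obtain ⟨f, hf⟩ := hagree.exists_partner
  have key : ∀ t ∈ S.tiles, t.leftEnd P ≤ 0 → 0 ≤ t.rightEnd P →
      ∃ u, |u| < η ∧ t.shift u ∈ T.tiles := by
    intro t ht h1 h2
    have hlt := t.leftEnd_lt_rightEnd P
    have hball : 1 ≤ 1 / ε := by rw [le_div_iff₀ hε0]; linarith
    obtain ⟨hmem, hd⟩ : f t ∈ T.tiles ∧ tileDist P t (f t) ≤ ε := by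
      rcases h2.lt_or_eq with h2 | h2
      · refine hf t ht (min (t.rightEnd P) 1 / 2) ?_ ?_ ?_
        · have : 0 < min (t.rightEnd P) 1 := lt_min h2 one_pos
          linarith
        · linarith [min_le_left (t.rightEnd P) 1]
        · have : 0 < min (t.rightEnd P) 1 := lt_min h2 one_pos
          rw [abs_of_pos (by linarith)]
          linarith [min_le_right (t.rightEnd P) 1]
      · refine hf t ht (max (t.leftEnd P) (-1) / 2) ?_ ?_ ?_
        · have : max (t.leftEnd P) (-1) < 0 := max_lt (by linarith) (by norm_num)
          linarith [le_max_left (t.leftEnd P) (-1)]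
        · have : max (t.leftEnd P) (-1) < 0 := max_lt (by linarith) (by norm_num)
          linarith
        · have : max (t.leftEnd P) (-1) < 0 := max_lt (by linarith) (by norm_num)
          rw [abs_of_neg (by linarith)]
          linarith [le_max_right (t.leftEnd P) (-1)]
    have hlab : t.label = (f t).label := hsep _ (hS t ht) _ (hT _ hmem)
      (((dist_label_le_tileDist P _ _).trans hd).trans_lt hεσ)
    refine ⟨t.leftEnd P - (f t).leftEnd P,
      ((abs_leftEnd_sub_le_tileDist P _ _).trans hd).trans_lt hεη, ?_⟩
    convert hmem
    exact Tile.ext_leftEnd P (by simp) hlab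
  -- The translations found for two tiles abutting at the origin agree, for lack of space.
  have habut : ∀ s ∈ S.tiles, ∀ t ∈ S.tiles, s.rightEnd P = 0 → t.leftEnd P = 0 → ∀ a b, |a| < η →
      |b| < η → s.shift a ∈ T.tiles → t.shift b ∈ T.tiles → a = b := by
    intro s _ t _ h1 h2 a b ha hb hsa htb
    have := T.rightEnd_eq_of_abs_lt hsa htb (by
      rw [Tile.rightEnd_shift, Tile.leftEnd_shift, h1, h2]
      rw [abs_lt] at *
      constructor <;> linarith)
    simpa [h1, h2] using this
  obtain ⟨t₀, ht₀, h1, h2⟩ := S.exists_mem 0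
  obtain ⟨u, hu, htu⟩ := key t₀ ht₀ h1 h2
  refine ⟨u, hu, fun t ht h3 h4 => ?_⟩
  obtain ⟨w, hw, htw⟩ := key t ht h3 h4
  rcases S.eq_or_rightEnd_le ht₀ ht with rfl | h | h
  · exact htu
  · rwa [habut t₀ ht₀ t ht (by linarith) (by linarith) u w hu hw htu htw]
  · rwa [← habut t ht t₀ ht₀ (by linarith) (by linarith) w u hw hu htw htu]

/-- Suppose that translates of `S` and `T` are close at all times, while the translation of `S`
sweeps over all of `S`.  Then `S` and `T` are translates of each other: the local translation which
matches them cannot change. -/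
theorem Tiling.exists_shift_eq_of_forall_exists {S T : Tiling P} {φ ψ : ℝ → ℝ} (hφ : Continuous φ)
    (hψ : Continuous ψ) (hφ0 : φ 0 = 0) (hψ0 : ψ 0 = 0) (hsurj : Function.Surjective φ) {η : ℝ}
    (hη : 0 < η) (hη' : 4 * η ≤ P.minLen)
    (h : ∀ x, ∃ u, |u| < η ∧ ∀ t ∈ (S.shift (φ x)).tiles, t.leftEnd P ≤ 0 → 0 ≤ t.rightEnd P →
      t.shift u ∈ (T.shift (ψ x)).tiles) :
    ∃ u, |u| < η ∧ S.shift u = T := by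
  choose u hu h using h
  let w : ℝ → ℝ := fun x => φ x + u x - ψ x
  have hw : ∀ x, ∀ t ∈ S.tiles, t.leftEnd P ≤ φ x → φ x ≤ t.rightEnd P →
      t.shift (w x) ∈ T.tiles := by
    intro x t ht h1 h2
    have := h x (t.shift (φ x)) ⟨t, ht, rfl⟩ (by simpa using h1) (by simpa using h2)
    rw [Tiling.mem_shift, Tile.shift_shift, Tile.shift_shift] at this
    convert this using 2
    simp only [w]; ring
  have hloc : IsLocallyConstant w := by
    refine (IsLocallyConstant.iff_eventually_eq w).2 fun x => ?_
    filter_upwards [hφ.continuousAt.eventually (S.eventually_exists_common (φ x)),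
      Metric.continuousAt_iff'.1 hφ.continuousAt _ hη,
      Metric.continuousAt_iff'.1 hψ.continuousAt _ hη] with y hy h1 h2
    obtain ⟨t, ht, ⟨h3, h4⟩, h5, h6⟩ := hy
    refine T.eq_of_shift_mem (hw y t ht h5 h6) (hw x t ht h3 h4) ?_
    have h7 := hu x
    have h8 := hu y
    rw [Real.dist_eq] at h1 h2
    rw [abs_lt] at *
    simp only [w]
    constructor <;> linarith
  have hw0 : ∀ x, w x = u 0 := fun x => by
    rw [hloc.apply_eq_of_preconnectedSpace x 0]
    simp [w, hφ0, hψ0]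
  refine ⟨u 0, hu 0, Tiling.eq_of_subset ?_⟩
  rintro _ ⟨t, ht, rfl⟩
  obtain ⟨x, hx⟩ := hsurj (t.leftEnd P)
  rw [← hw0 x]
  exact hw x t ht hx.ge (hx.trans_le (t.leftEnd_lt_rightEnd P).le)

/-- If close tilings are translates of each other by a vector shorter than half a tile, then they
are translates by a vector shorter than their distance. -/
theorem Tiling.abs_lt_of_tilingDist_shift_lt {T : Tiling P} {x ε : ℝ} (hε1 : ε ≤ 1)
    (hε : ε ≤ P.minLen / 2) (hx : |x| < P.minLen / 2) (h : tilingDist (T.shift x) T < ε) :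
    |x| < ε := by
  obtain ⟨ε', hε'0, hε', hagree⟩ := exists_agreeWithin_of_tilingDist_lt hε1 h
  obtain ⟨f, hf⟩ := hagree.exists_partner
  obtain ⟨t, ht, h1, h2, h3⟩ : ∃ t ∈ T.tiles, t.leftEnd P ≤ x ∧ x ≤ t.rightEnd P ∧
      x < t.rightEnd P := by
    obtain ⟨y, rfl⟩ := row_surjective P T
    obtain ⟨i, h1, h2⟩ := exists_vert_le_lt P y x
    exact ⟨tileAt P y i, ⟨i, rfl⟩, by simpa using h1, by simpa using h2.le, by simpa using h2⟩
  have hball : 0 < 1 / ε' := by positivity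
  set y := min ((t.rightEnd P - x) / 2) (1 / ε') with hy
  have hy0 : 0 < y := lt_min (by linarith) hball
  obtain ⟨hmem, hd⟩ := hf (t.shift x) ⟨t, ht, rfl⟩ y
    (by rw [Tile.leftEnd_shift]; linarith)
    (by rw [Tile.rightEnd_shift]; linarith [min_le_left ((t.rightEnd P - x) / 2) (1 / ε')])
    (by rw [abs_of_pos hy0]; exact min_le_right _ _)
  have hdl := (abs_leftEnd_sub_le_tileDist P _ _).trans hd
  rw [Tile.leftEnd_shift] at hdl
  have h4 := t.add_minLen_le P
  have h5 := (f (t.shift x)).add_minLen_le P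
  have heq : t = f (t.shift x) := by
    rw [abs_lt] at hx
    rw [abs_le] at hdl
    rcases T.eq_or_rightEnd_le ht hmem with h | h | h
    · exact h
    · linarith
    · linarith
  rw [← heq, sub_sub_cancel_left, abs_neg] at hdl
  exact hdl.trans_lt hε'

/-- A tiling space with totally disconnected label sequences which is homeomorphic to a tiling space
with finite local complexity is strongly expansive.  The homeomorphism maps orbits to orbits, so
that it transports the close paths to paths in the second space, where the tiles near the origin
determine the local translation between close tilings. -/
theorem stronglyExpansive_of_homeomorph {L' : Type v} [MetricSpace L']
    [CompactSpace L'] {P' : Prototiles L'} {Ω' : Set (Tiling P')} (hΩ : IsTilingSpace Ω)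
    (hΩ' : IsTilingSpace Ω') (htd : IsTotallyDisconnected (sequences Ω)) (hflc : HasFLC Ω')
    (f : Ω ≃ₜ Ω') : StronglyExpansive Ω := by
  have hcpt : CompactSpace Ω := isCompact_iff_compactSpace.1 hΩ.isClosed.isCompact
  have hδ := P.minLen_pos
  have hδ' := P'.minLen_pos
  have htd' := hflc.isTotallyDisconnected_sequences
  obtain ⟨A, hA, hlab⟩ := hflc.finite_labels
  -- Translating by half a tile in `Ω` cannot correspond to translating by less than `η` in `Ω'`.
  obtain ⟨η, hη, hη4, hstep⟩ : ∃ η > 0, 4 * η < P'.minLen ∧ ∀ y, |y| < η → ∀ T : Ω, ∀ x,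
      |x| = P.minLen / 2 → f (hΩ.shift T x) ≠ hΩ'.shift (f T) y := by
    have hK : IsCompact ((univ : Set Ω) ×ˢ {x : ℝ | |x| = P.minLen / 2}) := by
      refine isCompact_univ.prod ((isCompact_Icc (a := -(P.minLen / 2))
        (b := P.minLen / 2)).of_isClosed_subset (isClosed_eq continuous_abs continuous_const)
        fun x hx => abs_le.1 (le_of_eq hx))
    have key : ∀ z ∈ (univ : Set Ω) ×ˢ {x : ℝ | |x| = P.minLen / 2},
        ∀ᶠ w : ℝ × (Ω × ℝ) in 𝓝 (0, z),
          f (hΩ.shift w.2.1 w.2.2) ≠ hΩ'.shift (f w.2.1) w.1 := by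
      rintro ⟨T, x⟩ ⟨-, hx⟩
      refine (isOpen_ne_fun (f.continuous.comp (hΩ.continuous_shift.comp continuous_snd))
        (hΩ'.continuous_shift.comp ((f.continuous.comp (continuous_fst.comp continuous_snd)).prodMk
          continuous_fst))).mem_nhds ?_
      intro h
      change f (hΩ.shift T x) = hΩ'.shift (f T) 0 at h
      rw [IsTilingSpace.shift_zero] at h
      have hx' : |x| = P.minLen / 2 := hx
      have h0 : x = 0 := hΩ.shift_injective_of_lt (T := T) (by simpa using f.injective h)
        (by rw [sub_zero, hx']; linarith)
      rw [h0, abs_zero] at hx'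
      linarith
    have := hK.eventually_forall_of_forall_eventually (P := fun (y : ℝ) (z : Ω × ℝ) =>
      f (hΩ.shift z.1 z.2) ≠ hΩ'.shift (f z.1) y) key
    obtain ⟨ρ, hρ, h⟩ := Metric.eventually_nhds_iff.1 this
    refine ⟨min ρ (P'.minLen / 8), by positivity, ?_, fun y hy T x hx => ?_⟩
    · linarith [min_le_right ρ (P'.minLen / 8)]
    · exact h (by rw [Real.dist_eq, sub_zero]; exact hy.trans_le (min_le_left _ _)) (T, x)
        ⟨trivial, hx⟩
  obtain ⟨ε', hε', hclose⟩ := exists_tilingDist_lt_imp_exists_shift_mem (P := P') hA hη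
    (by linarith)
  obtain ⟨γ, hγ, hunif⟩ := exists_tilingDist_lt_of_continuous hΩ.isClosed
    (continuous_subtype_val.comp f.continuous) hε'
  -- Orbits are mapped to orbits, in both directions.
  have hlift : ∀ (T : Ω) (k : ℝ → ℝ), Continuous k → k 0 = 0 → ∃ φ : ℝ → ℝ, Continuous φ ∧
      φ 0 = 0 ∧ ∀ x, f (hΩ.shift T (k x)) = hΩ'.shift (f T) (φ x) := by
    intro T k hk hk0
    obtain ⟨φ, h1, h2, h3⟩ := exists_lift hΩ' htd' (α := fun x => (f (hΩ.shift T (k x))).1)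
      (continuous_subtype_val.comp (f.continuous.comp
        (hΩ.continuous_shift.comp (continuous_const.prodMk hk)))) fun x => (f _).2
    refine ⟨φ, h1, h2, fun x => Subtype.ext ?_⟩
    rw [h3 x, hk0, hΩ.shift_zero]
    rfl
  have hlift' : ∀ T : Ω, ∃ ψ : ℝ → ℝ, Continuous ψ ∧ ψ 0 = 0 ∧
      ∀ y, f (hΩ.shift T (ψ y)) = hΩ'.shift (f T) y := by
    intro T
    obtain ⟨ψ, h1, h2, h3⟩ := exists_lift hΩ htd (α := fun y => (f.symm (hΩ'.shift (f T) y)).1)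
      (continuous_subtype_val.comp (f.symm.continuous.comp
        (hΩ'.continuous_shift.comp (Continuous.prodMk_right _)))) fun x => (f.symm _).2
    refine ⟨ψ, h1, h2, fun y => ?_⟩
    rw [← f.apply_symm_apply (hΩ'.shift (f T) y)]
    congr 1
    refine Subtype.ext ?_
    rw [h3 y, hΩ'.shift_zero, f.symm_apply_apply]
    rfl
  have hsurj : ∀ (T : Ω) (φ : ℝ → ℝ), Continuous φ → φ 0 = 0 →
      (∀ x, f (hΩ.shift T x) = hΩ'.shift (f T) (φ x)) → Function.Surjective φ := by
    intro T φ hφ hφ0 h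
    obtain ⟨ψ, hψ, hψ0, hψf⟩ := hlift' T
    -- `φ ∘ ψ - id` takes its values in the discrete group of periods.
    have hper : ∀ y, hΩ'.shift (f T) (φ (ψ y)) = hΩ'.shift (f T) y := fun y => by
      rw [← h, hψf]
    have hper' : ∀ y, hΩ'.shift (f T) (φ (ψ y) - y) = f T := fun y => by
      have := congrArg (fun S : Ω' => S.1.shift (-y)) (hper y)
      simp only [IsTilingSpace.shift, Tiling.shift_shift, add_neg_cancel, Tiling.shift_zero] at this
      rw [← sub_eq_add_neg] at this
      exact Subtype.ext this
    have hcont : Continuous fun y => φ (ψ y) - y := (hφ.comp hψ).sub continuous_id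
    have hloc : IsLocallyConstant fun y => φ (ψ y) - y := by
      refine (IsLocallyConstant.iff_eventually_eq _).2 fun x => ?_
      filter_upwards [Metric.continuousAt_iff'.1 hcont.continuousAt _ hδ'] with y hy
      exact hΩ'.shift_injective_of_lt ((hper' y).trans (hper' x).symm) hy
    intro y
    refine ⟨ψ y, ?_⟩
    have := hloc.apply_eq_of_preconnectedSpace y 0
    simp only [hψ0, hφ0, sub_zero] at this
    linarith
  refine ⟨min (min γ 1) (P.minLen / 2), by positivity, fun T hT T' hT' ⟨h, h0, hh⟩ => ?_⟩
  obtain ⟨φ, hφ, hφ0, hφf⟩ := hlift ⟨T, hT⟩ id continuous_id rfl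
  obtain ⟨ψ, hψ, hψ0, hψf⟩ := hlift ⟨T', hT'⟩ h h.continuous h0
  obtain ⟨u, hu, hST⟩ : ∃ u, |u| < η ∧
      (f ⟨T', hT'⟩).1.shift u = (f ⟨T, hT⟩).1 := by
    obtain ⟨u, hu, hST⟩ := Tiling.exists_shift_eq_of_forall_exists
      (S := (f ⟨T, hT⟩).1) (T := (f ⟨T', hT'⟩).1) hφ hψ hφ0 hψ0
      (hsurj ⟨T, hT⟩ φ hφ hφ0 hφf) hη hη4.le fun x => by
        have hd := hunif (hΩ.shift ⟨T, hT⟩ x) (hΩ.shift ⟨T', hT'⟩ (h x))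
          ((hh x).trans_le ((min_le_left _ _).trans (min_le_left _ _)))
        have h1 : f (hΩ.shift ⟨T, hT⟩ x) = hΩ'.shift (f ⟨T, hT⟩) (φ x) := hφf x
        simp only [Function.comp_apply, h1, hψf] at hd
        exact hclose _ _ (hlab _ (hΩ'.shift _ _).2) (hlab _ (hΩ'.shift _ _).2) hd
    refine ⟨-u, by rwa [abs_neg], ?_⟩
    rw [← hST, Tiling.shift_shift, add_neg_cancel, Tiling.shift_zero]
  obtain ⟨k, hk, hk0, hkf⟩ := hlift' ⟨T', hT'⟩
  have hTT' : T = T'.shift (k u) := by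
    have h1 : f (hΩ.shift ⟨T', hT'⟩ (k u)) = f ⟨T, hT⟩ := by
      rw [hkf]
      exact Subtype.ext hST
    exact (congrArg Subtype.val (f.injective h1)).symm
  have hku : |k u| < P.minLen / 2 := by
    by_contra! hle
    have hmem : P.minLen / 2 ∈ (fun y => |k y|) '' uIcc 0 u :=
      intermediate_value_uIcc (hk.abs.continuousOn) (by
        simp only [hk0, abs_zero]
        exact mem_uIcc_of_le (by linarith) hle)
    obtain ⟨y, hy, hky⟩ := hmem
    refine hstep y ?_ ⟨T', hT'⟩ (k y) hky (hkf y)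
    have := abs_sub_left_of_mem_uIcc hy
    rw [sub_zero, sub_zero] at this
    exact this.trans_lt hu
  have hd := hh 0
  rw [h0, Tiling.shift_zero, Tiling.shift_zero, hTT'] at hd
  have hlt := Tiling.abs_lt_of_tilingDist_shift_lt ((min_le_left _ _).trans (min_le_right _ _))
    (min_le_right _ _) hku hd
  exact ⟨k u, hlt, hTT'⟩

end Expansive

/-! ### Symbolic coding of expansive actions -/

section Coding

/-- In a compact totally disconnected space, a closed set of pairs of distinct points is separated
by a continuous colouring with finitely many colours. -/
theorem exists_finite_code {Y : Type*} [TopologicalSpace Y] [CompactSpace Y] [T2Space Y]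
    [TotallyDisconnectedSpace Y] {K : Set (Y × Y)} (hK : IsClosed K)
    (hne : ∀ p ∈ K, p.1 ≠ p.2) :
    ∃ (n : ℕ) (κ : Y → Fin n), Continuous κ ∧ ∀ p ∈ K, κ p.1 ≠ κ p.2 := by
  classical
  choose! D hD hD1 hD2 using fun p (hp : p ∈ K) => exists_isClopen_of_totally_separated (hne p hp)
  obtain ⟨t, htK, ht⟩ := hK.isCompact.elim_nhds_subcover (fun p => D p ×ˢ (D p)ᶜ) fun p hp =>
    (((hD p hp).isOpen.prod (hD p hp).compl.isOpen).mem_nhds ⟨hD1 p hp, hD2 p hp⟩)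
  let κ : Y → (t → Prop) := fun y p => y ∈ D p
  have hκ : IsLocallyConstant κ := by
    refine (IsLocallyConstant.iff_eventually_eq κ).2 fun y => ?_
    have h1 : ∀ p : t, ∀ᶠ z in 𝓝 y, (z ∈ D p) = (y ∈ D p) := fun p => by
      have hp := hD p.1 (htK p.1 p.2)
      by_cases hy : y ∈ D p
      · filter_upwards [hp.isOpen.mem_nhds hy] with z hz
        simp [hz, hy]
      · filter_upwards [hp.compl.isOpen.mem_nhds hy] with z hz
        simp only [mem_compl_iff] at hz
        simp [hz, hy]
    filter_upwards [eventually_all.2 h1] with z hz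
    exact funext hz
  refine ⟨_, fun y => Fintype.equivFin (t → Prop) (κ y), (hκ.comp _).continuous, fun p hp h => ?_⟩
  have h' : κ p.1 = κ p.2 := (Fintype.equivFin _).injective h
  obtain ⟨q, hq, hpq⟩ := mem_iUnion₂.1 (ht hp)
  exact hpq.2 ((iff_of_eq (congrFun h' ⟨q, hq⟩)).1 hpq.1)

theorem finite_setOf_periodic {A : Type*} [Finite A] {k : ℤ} (hk : k ≠ 0) :
    {s : ℤ → A | Function.Periodic s k}.Finite := by
  have hinj : InjOn (fun (s : ℤ → A) (j : Finset.Ico 0 |k|) => s j)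
      {s : ℤ → A | Function.Periodic s k} := by
    intro s hs s' hs' h
    ext i
    have hmod : ∀ s : ℤ → A, Function.Periodic s k → s (i % k) = s i := fun s hs => by
      have := hs.sub_zsmul_eq (x := i) (i / k)
      rw [← this, Int.emod_def, smul_eq_mul, mul_comm]
    rw [← hmod s hs, ← hmod s' hs']
    exact congrFun h ⟨i % k, Finset.mem_Ico.2 ⟨Int.emod_nonneg _ hk, Int.emod_lt_abs _ hk⟩⟩
  exact Finite.of_injOn (mapsTo_univ _ _) hinj finite_univ

/-- Let the integers act on a compact totally disconnected space so that points whose orbits are not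
separated by a fixed closed set of pairs of distinct points are on the same orbit, a bounded time
apart.  Then the action is conjugate to a subshift.  Indeed, for the symbolic coding by a
partition which separates these pairs, points with the same code have a periodic code with bounded
period as soon as they are distinct; so there are only finitely many such points, and a finer
partition separates them. -/
theorem exists_injective_code {Y : Type*} [TopologicalSpace Y] [CompactSpace Y] [T2Space Y]
    [TotallyDisconnectedSpace Y] (τ : ℤ → Y → Y) (h0 : ∀ y, τ 0 y = y)
    (hadd : ∀ k l y, τ k (τ l y) = τ (k + l) y) {G : Set (Y × Y)} (hG : IsClosed G)
    (hne : ∀ p ∈ G, p.1 ≠ p.2) (K : ℕ)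
    (hexp : ∀ y z, (∀ k, (τ k y, τ k z) ∉ G) → ∃ k : ℤ, |k| ≤ K ∧ y = τ k z) :
    ∃ (n : ℕ) (κ : Y → Fin n), Continuous κ ∧ ∀ y z, (∀ k, κ (τ k y) = κ (τ k z)) → y = z := by
  obtain ⟨n, κ, hκ, hκG⟩ := exists_finite_code hG hne
  let code : Y → ℤ → Fin n := fun y k => κ (τ k y)
  have hcode : ∀ y z, code y = code z → ∃ k : ℤ, |k| ≤ K ∧ y = τ k z := fun y z h =>
    hexp y z fun k hk => hκG _ hk (congrFun h k)
  let Y₀ : Set Y := code ⁻¹' ⋃ k ∈ {k : ℤ | |k| ≤ K ∧ k ≠ 0}, {s | Function.Periodic s k}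
  have hfinK : {k : ℤ | |k| ≤ K}.Finite :=
    (finite_Icc (-K : ℤ) K).subset fun k hk => abs_le.1 hk
  have hY₀ : Y₀.Finite := by
    refine Finite.preimage' ((hfinK.subset fun k hk => hk.1).biUnion fun k hk =>
      finite_setOf_periodic hk.2) fun s _ => ?_
    rcases (code ⁻¹' {s}).eq_empty_or_nonempty with he | ⟨z, hz⟩
    · rw [he]; exact finite_empty
    · refine (hfinK.image fun k => τ k z).subset fun y hy => ?_
      obtain ⟨k, hk, rfl⟩ := hcode y z (Eq.trans hy (Eq.symm hz))
      exact ⟨k, hk, rfl⟩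
  have hcl : IsClosed ({p : Y × Y | κ p.1 ≠ κ p.2} ∪ Y₀.offDiag) := by
    refine IsClosed.union ?_ hY₀.offDiag.isClosed
    exact (isClopen_discrete {p : Fin n × Fin n | p.1 ≠ p.2}).1.preimage
      ((hκ.comp continuous_fst).prodMk (hκ.comp continuous_snd))
  obtain ⟨m, μ, hμ, hsep⟩ := exists_finite_code hcl (by
    rintro p (hp | hp) h
    · exact hp (by rw [h])
    · exact hp.2.2 h)
  refine ⟨m, μ, hμ, fun y z h => ?_⟩
  have hyz : code y = code z := by
    ext1 k
    by_contra hk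
    exact hsep (τ k y, τ k z) (Or.inl hk) (h k)
  obtain ⟨k, hk, rfl⟩ := hcode y z hyz
  rcases eq_or_ne k 0 with rfl | hk0
  · exact h0 z
  have hper : Function.Periodic (code z) k := fun i => by
    have := congrFun hyz i
    simpa only [code, hadd] using this
  have hz : z ∈ Y₀ := mem_iUnion₂.2 ⟨k, ⟨hk, hk0⟩, hper⟩
  have hy : τ k z ∈ Y₀ := mem_preimage.2 (by rw [hyz]; exact hz)
  by_contra hcon
  exact hsep (τ k z, z) (Or.inr ⟨hy, hz, hcon⟩) (by simpa [h0] using h 0)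

end Coding

/-! ### Strong expansivity of label sequences -/

section Expansive

variable {L : Type u} [MetricSpace L] [CompactSpace L] {P : Prototiles L} {Ω : Set (Tiling P)}

/-- Strong expansivity in terms of label sequences: sequences which never differ by a pair in a
certain closed set of pairs of distinct sequences are renumberings of each other, by a bounded
amount. -/
theorem StronglyExpansive.exists_closed_pairs (h : StronglyExpansive Ω) :
    ∃ (G : Set ((ℤ → L) × (ℤ → L))) (K : ℕ), IsClosed G ∧ (∀ p ∈ G, p.1 ≠ p.2) ∧
      ∀ c d, row P (0, c) ∈ Ω → row P (0, d) ∈ Ω →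
        (∀ k, (renumber k c, renumber k d) ∉ G) → ∃ k : ℤ, |k| ≤ K ∧ c = renumber k d := by
  obtain ⟨ε, hε, h⟩ := h
  let B : ((ℤ → L) × (ℤ → L)) × ℝ → Tiling P × Tiling P := fun z =>
    (row P (z.2, z.1.1), row P (z.2, z.1.2))
  have hB : Continuous B :=
    ((continuous_row P).comp (continuous_snd.prodMk (continuous_fst.comp continuous_fst))).prodMk
      ((continuous_row P).comp (continuous_snd.prodMk (continuous_snd.comp continuous_fst)))
  let O : Set (Tiling P × Tiling P) := interior {z | tilingDist z.1 z.2 < ε}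
  refine ⟨Prod.fst '' (B ⁻¹' Oᶜ ∩ univ ×ˢ Icc (0 : ℝ) 1), ⌈ε / P.minLen⌉₊, ?_, ?_, ?_⟩
  · refine (IsCompact.image ?_ continuous_fst).isClosed
    exact (isCompact_univ.prod isCompact_Icc).inter_left
      (isOpen_interior.isClosed_compl.preimage hB)
  · rintro _ ⟨⟨⟨c, d⟩, r⟩, ⟨hO, -⟩, rfl⟩ hcd
    obtain rfl : c = d := hcd
    refine hO (mem_interior_iff_mem_nhds.2 ?_)
    rw [nhds_prod_eq]
    exact eventually_tilingDist_lt _ hε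
  · intro c d hc hd hcd
    have hclose : ∀ r, tilingDist (row P (r, c)) (row P (r, d)) < ε := by
      intro r
      rw [← row_vadd P ⌊r⌋ (r, c), ← row_vadd P ⌊r⌋ (r, d)]
      simp only [vadd_def]
      by_contra hcon
      refine hcd ⌊r⌋ ⟨((renumber ⌊r⌋ c, renumber ⌊r⌋ d), r - ⌊r⌋), ⟨fun hO => ?_, trivial, ?_⟩, rfl⟩
      · exact hcon (interior_subset (s := {z : Tiling P × Tiling P | tilingDist z.1 z.2 < ε}) hO)
      · exact ⟨by linarith [Int.floor_le r], by linarith [Int.lt_floor_add_one r]⟩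
    -- The time change maps the vertices of one tiling to those of the other.
    let φ : ℝ ≃ₜ ℝ := ((arcIso P c 0).symm.trans (arcIso P d 0)).toHomeomorph
    have hφ0 : φ 0 = 0 := by
      have : (arcIso P c 0).symm 0 = 0 := by
        rw [OrderIso.symm_apply_eq, arcIso_apply, arc_self]
      simp [φ, this]
    have hφ : ∀ y, tilingDist ((row P (0, c)).shift y) ((row P (0, d)).shift (φ y)) < ε := by
      intro y
      obtain ⟨r, rfl⟩ := (arcIso P c 0).surjective y
      have h1 : φ (arcIso P c 0 r) = arc P d 0 r := by
        change arc P d 0 ((arcIso P c 0).symm (arcIso P c 0 r)) = _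
        rw [OrderIso.symm_apply_apply]
      rw [h1, arcIso_apply, row_shift, row_shift]
      exact hclose r
    obtain ⟨x, hx, hxeq⟩ := h _ hc _ hd ⟨φ, hφ0, hφ⟩
    obtain ⟨r, hr, hrow⟩ := exists_row_shift P 0 x d
    rw [hrow] at hxeq
    obtain ⟨k, hk⟩ := (row_eq_row_iff P).1 hxeq
    have hkr : (k : ℝ) = r := by
      have := congrArg Prod.fst hk
      simp only [vadd_def] at this
      linarith
    refine ⟨k, ?_, (congrArg Prod.snd hk).symm⟩
    have h1 := mul_abs_le_abs_arc P d 0 r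
    rw [hr, sub_zero, ← hkr] at h1
    have h2 : |(k : ℝ)| ≤ ε / P.minLen := by
      rw [le_div_iff₀ P.minLen_pos, mul_comm]
      exact h1.trans hx.le
    exact_mod_cast h2.trans (Nat.le_ceil _)

/-- A patch of two tiles of a row consists of consecutive tiles. -/
theorem exists_eq_pair_of_isPatch {x : ℝ × (ℤ → L)} {p : Set (Tile L)} (hp : IsPatch P p)
    (h2 : p.ncard = 2) (hsub : p ⊆ (row P x).tiles) :
    ∃ i, p = {tileAt P x i, tileAt P x (i + 1)} := by
  obtain ⟨s, t, hst, rfl⟩ := ncard_eq_two.1 h2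
  obtain ⟨i, rfl⟩ := hsub (mem_insert _ _)
  obtain ⟨j, rfl⟩ := hsub (mem_insert_of_mem _ rfl)
  have key : ∀ i j, IsPatch P {tileAt P x i, tileAt P x j} → i < j → j = i + 1 := by
    intro i j hp hij
    by_contra hne
    have hoc := hp.2.isPreconnected.ordConnected
    simp only [biUnion_insert, biUnion_singleton, supp_eq_Icc, tileAt_leftEnd,
      tileAt_rightEnd] at hoc
    have h1 := (vert_lt_iff P x).2 (lt_add_one i)
    have h2 := (vert_lt_iff P x).2 (lt_add_one (i + 1))
    have h3 := (vert_le_iff P x).2 (show i + 1 + 1 ≤ j by omega)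
    have h4 := (vert_lt_iff P x).2 (lt_add_one j)
    have hmem := hoc.out (Or.inl (left_mem_Icc.2 h1.le)) (Or.inr (left_mem_Icc.2 h4.le))
      (show (vert P x (i + 1) + vert P x (i + 1 + 1)) / 2 ∈ Icc (vert P x i) (vert P x j) by
        constructor <;> linarith)
    rcases hmem with h | h
    · linarith [h.2]
    · linarith [h.1]
  rcases lt_trichotomy i j with h | rfl | h
  · exact ⟨i, by rw [key i j hp h]⟩
  · exact (hst rfl).elim
  · rw [pair_comm] at hp ⊢
    exact ⟨j, by rw [key j i hp h]⟩

end Expansive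

/-! ### Realization by unit tiles -/

section Realization

/-- Prototiles of length one, with control points at their left ends. -/
def unitPrototiles (A : Type v) [MetricSpace A] : Prototiles A where
  left _ := 0
  right _ := 1
  left_lt_right _ := one_pos
  left_nonpos _ := le_rfl
  right_nonneg _ := zero_le_one
  continuous_left := continuous_const
  continuous_right := continuous_const

theorem hasFLC_unitPrototiles {A : Type v} [MetricSpace A] [CompactSpace A] [Finite A]
    (Ω : Set (Tiling (unitPrototiles A))) : HasFLC Ω := by
  refine ⟨range fun a : A × A => {⟨0, a.1⟩, ⟨1, a.2⟩}, finite_range _, ?_⟩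
  rintro p ⟨hp, h2, T, -, hsub⟩
  obtain ⟨x, rfl⟩ := row_surjective _ T
  obtain ⟨i, rfl⟩ := exists_eq_pair_of_isPatch hp h2 hsub
  refine ⟨_, ⟨(x.2 i, x.2 (i + 1)), rfl⟩, -vert (unitPrototiles A) x i, ?_⟩
  have h1 : ∀ a, (unitPrototiles A).len a = 1 := fun _ => sub_zero _
  have h2 : ∀ a, (unitPrototiles A).left a = 0 := fun _ => rfl
  simp [image_pair, tileAt, Tile.shift, vert_add_one, h1, h2, add_comm]

theorem nonempty_homeomorph_of_isQuotientMap {X Y Z : Type*} [TopologicalSpace X]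
    [TopologicalSpace Y] [TopologicalSpace Z] {q : X → Y} {q' : X → Z} (hq : IsQuotientMap q)
    (hq' : IsQuotientMap q') (h : ∀ a b, q a = q b ↔ q' a = q' b) : Nonempty (Y ≃ₜ Z) := by
  let f : C(X, Y) := ⟨q, hq.continuous⟩
  let g : C(X, Z) := ⟨q', hq'.continuous⟩
  have hf : IsQuotientMap f := hq
  have hg : IsQuotientMap g := hq'
  have hker : Setoid.ker f = Setoid.ker g := Setoid.ext h
  have e : Quotient (Setoid.ker f) ≃ₜ Z := by
    rw [hker]
    exact hg.homeomorph
  exact ⟨hf.homeomorph.symm.trans e⟩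

variable {L : Type u} [MetricSpace L] [CompactSpace L] {P : Prototiles L} {Ω : Set (Tiling P)}

/-- A tiling space with label sequences `Y` is a mapping torus of the shift of `Y`, regardless of
the lengths of the tiles; so it is homeomorphic to the space of tilings, by any other prototiles,
whose label sequences are the image of `Y` under a continuous injective coding. -/
theorem exists_homeomorph_of_code {A : Type v} [MetricSpace A] [CompactSpace A]
    (P' : Prototiles A) (hΩ : IsTilingSpace Ω) (κ : sequences Ω → A) (hκ : Continuous κ)
    (hinj : ∀ c d : sequences Ω, (∀ k, κ ⟨renumber k c.1, renumber_mem_sequences hΩ k c.2⟩ =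
      κ ⟨renumber k d.1, renumber_mem_sequences hΩ k d.2⟩) → c = d) :
    ∃ Ω' : Set (Tiling P'), IsTilingSpace Ω' ∧ Nonempty (Ω ≃ₜ Ω') := by
  have hcpt : CompactSpace (sequences Ω) :=
    isCompact_iff_compactSpace.1 (isClosed_sequences hΩ).isCompact
  let τ : ℤ → sequences Ω → sequences Ω := fun k c =>
    ⟨renumber k c.1, renumber_mem_sequences hΩ k c.2⟩
  let Φ : sequences Ω → ℤ → A := fun c k => κ (τ k c)
  have hΦ : Continuous Φ := continuous_pi fun k => hκ.comp
    (((continuous_renumber k).comp continuous_subtype_val).subtype_mk _)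
  have hΦinj : Function.Injective Φ := fun c d h => hinj c d fun k => congrFun h k
  have hΦτ : ∀ k c, Φ (τ k c) = renumber k (Φ c) := fun k c => by
    ext1 l
    simp only [Φ, τ, renumber_renumber, renumber_apply]
  let Ω' : Set (Tiling P') := range fun z : ℝ × sequences Ω => row P' (z.1, Φ z.2)
  -- Both spaces are quotients of `[0, 1] × Y` by the same identifications.
  let q : Icc (0 : ℝ) 1 × sequences Ω → Ω := fun z =>
    ⟨row P (z.1, z.2), (mem_sequences_iff hΩ _ _).1 z.2.2⟩
  let q' : Icc (0 : ℝ) 1 × sequences Ω → Ω' := fun z => ⟨row P' (z.1, Φ z.2), ⟨(z.1, z.2), rfl⟩⟩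
  have hq : Continuous q := ((continuous_row P).comp
    ((continuous_subtype_val.comp continuous_fst).prodMk
      (continuous_subtype_val.comp continuous_snd))).subtype_mk _
  have hq' : Continuous q' := ((continuous_row P').comp
    ((continuous_subtype_val.comp continuous_fst).prodMk
      (hΦ.comp continuous_snd))).subtype_mk _
  have hqs : Function.Surjective q := by
    rintro ⟨T, hT⟩
    obtain ⟨x, hx, rfl⟩ := exists_row_eq_of_mem_Icc P T
    exact ⟨(⟨x.1, hx⟩, ⟨x.2, (mem_sequences_iff hΩ x.1 x.2).2 hT⟩), rfl⟩
  have hqs' : Function.Surjective q' := by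
    rintro ⟨_, ⟨r, c⟩, rfl⟩
    refine ⟨(⟨r - ⌊r⌋, by linarith [Int.floor_le r], by linarith [Int.lt_floor_add_one r]⟩,
      τ ⌊r⌋ c), Subtype.ext ?_⟩
    change row P' (r - ⌊r⌋, Φ (τ ⌊r⌋ c)) = row P' (r, Φ c)
    rw [hΦτ]
    exact row_vadd P' ⌊r⌋ (r, Φ c)
  refine ⟨Ω', ⟨?_, ?_⟩, nonempty_homeomorph_of_isQuotientMap
    (IsQuotientMap.of_surjective_continuous hqs hq)
    (IsQuotientMap.of_surjective_continuous hqs' hq') fun a b => ?_⟩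
  · have : Ω' = range (Subtype.val ∘ q') := by
      rw [range_comp, hqs'.range_eq, image_univ, Subtype.range_coe]
    rw [this]
    exact (isCompact_range (continuous_subtype_val.comp hq')).isClosed
  · rintro _ ⟨⟨r, c⟩, rfl⟩ x
    obtain ⟨r', -, h⟩ := exists_row_shift P' r x (Φ c)
    exact ⟨(r', c), h.symm⟩
  · rw [Subtype.ext_iff, Subtype.ext_iff]
    change row P (a.1, a.2) = row P (b.1, b.2) ↔ row P' (a.1, Φ a.2) = row P' (b.1, Φ b.2)
    rw [row_eq_row_iff, row_eq_row_iff]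
    refine exists_congr fun k => ?_
    simp only [vadd_def, Prod.mk.injEq, ← hΦτ]
    refine and_congr_right fun _ => ?_
    exact ⟨fun h => congrArg Φ (Subtype.ext h : τ k b.2 = a.2), fun h =>
      congrArg Subtype.val (hΦinj h)⟩

end Realization

end LineTiling

end

theorem mainTheorem4 {L : Type u} [MetricSpace L] [CompactSpace L]
    (P : LineTiling.Prototiles L) (Ω : Set (LineTiling.Tiling P))
    (hΩ : LineTiling.IsTilingSpace Ω) :
    (∃ (L' : Type v) (_ : MetricSpace L') (_ : CompactSpace L') (P' : LineTiling.Prototiles L')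
        (Ω' : Set (LineTiling.Tiling P')),
        LineTiling.IsTilingSpace Ω' ∧ LineTiling.HasFLC Ω' ∧ Nonempty (Ω ≃ₜ Ω')) ↔
      LineTiling.StronglyExpansive Ω ∧ IsTotallyDisconnected (LineTiling.transversal Ω) := by
  open LineTiling in
  constructor
  · rintro ⟨L', _, _, P', Ω', hΩ', hflc, ⟨f⟩⟩
    have htd := isTotallyDisconnected_transversal_of_homeomorph hΩ hΩ'
      hflc.isTotallyDisconnected_sequences f
    exact ⟨stronglyExpansive_of_homeomorph hΩ hΩ' (isTotallyDisconnected_sequences htd hΩ) hflc f,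
      htd⟩
  · rintro ⟨hse, htd⟩
    have : CompactSpace (sequences Ω) :=
      isCompact_iff_compactSpace.1 (isClosed_sequences hΩ).isCompact
    have : TotallyDisconnectedSpace (sequences Ω) :=
      totallyDisconnectedSpace_subtype_iff.2 (isTotallyDisconnected_sequences htd hΩ)
    obtain ⟨G, K, hG, hne, hexp⟩ := hse.exists_closed_pairs
    obtain ⟨n, κ, hκ, hinj⟩ := exists_injective_code
      (fun (k : ℤ) (c : sequences Ω) =>
        (⟨renumber k c.1, renumber_mem_sequences hΩ k c.2⟩ : sequences Ω))
      (fun c => Subtype.ext (renumber_zero c.1))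
      (fun k l c => Subtype.ext (renumber_renumber k l c.1))
      (hG.preimage (continuous_subtype_val.prodMap continuous_subtype_val))
      (fun p hp h => hne _ hp (congrArg Subtype.val h)) K fun c d h => by
        obtain ⟨k, hk, hcd⟩ := hexp c d c.2 d.2 h
        exact ⟨k, hk, Subtype.ext hcd⟩
    let := TopologicalSpace.metrizableSpaceMetric (ULift.{v} (Fin n))
    obtain ⟨Ω', hΩ', hf⟩ := exists_homeomorph_of_code (unitPrototiles (ULift.{v} (Fin n))) hΩ
      (fun c => ULift.up (κ c)) (continuous_uliftUp.comp hκ) fun c d h =>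
        hinj c d fun k => ULift.up_injective (h k)
    exact ⟨ULift.{v} (Fin n), this, inferInstance, _, Ω', hΩ', hasFLC_unitPrototiles Ω', hf⟩
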